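/- **Setting.** There are $n$ jobs $J=\{1,\dots,n\}$ with processing times $p_j>0$ and weights $w_j>0$. A schedule is an order of all jobs, processed without idle time from time $0$; $t_j$ is the start time and $C_j=t_j+p_j$ the completion time of job $j$. The airplane refueling problem asks for a schedule minimizing $\sum_j -w_j/C_j$. **Potential schedules.** Put $\varphi_j(t)=\dfrac{w_j}{p_j(p_j+t)}$ and $t^*_{ij}=\dfrac{w_jp_i^2-w_ip_j^2}{w_ip_j-w_jp_i}$ (with $t^*_{ij}=0$ if the denominator vanishes). The dominance rule consists of the following relations, for all jobs $i,j$ with $w_i<w_j$: (1) if $\varphi_i(t)\ge\varphi_j(t)$ for all $t\ge 0$, then $i\prec_{g[0,\infty)}j$; (2) if $\varphi_j(t)\ge\varphi_i(t)$ for all $t\ge0$, then $j\prec_{g[0,\infty)}i$; (3) otherwise $i\prec_{g[0,t^*_{ij})}j$ and $j\prec_{g[t^*_{ij},\infty)}i$. A schedule violates $i\prec_{g\,I}j$ if $t_j\le t_i-p_j$ and both $t_j$ and $t_i-p_j$ lie in $I$. A potential schedule is a schedule that violates no relation of the rule; $K$ is the number of potential schedules. **Algorithm.** First all $t^*_{ij}$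 and $c_{ij}=t^*_{ij}+p_j$ are computed and, for every $i$, the jobs $j$ are sorted by $t^*_{ij}$ and by $c_{ij}$. Then $\mathrm{FastSchedule}(J,0)$ is called. The call $\mathrm{FastSchedule}(J',t)$ returns a value and a sequence of the jobs of $J'$: if $J'=\emptyset$, it returns $0$ and the empty sequence; if $J'=\{j\}$, it returns $w_j/(p_j+t)$ and $[j]$. Otherwise put $t_e=t+\sum_{j\in J'}p_j$ and let $\alpha\in J'$ have maximum $\varphi_\alpha(t)$, ties being broken by maximum $\varphi_\alpha(t_e)$. Let $c_1=t$, followed in nondecreasing order by the $c_{\alpha j}$ of the jobs $j\in J'\setminus\{\alpha\}$ with $t^*_{\alpha j}\in(t,t_e)$ and $c_{\alpha j}<t_e$, and finally $t_e$. For each $q$ with a successor $c_{q+1}$, let $J_l$ be the set of the jobs whose $c_{\alpha j}$ is among $c_2,\dots,c_q$, let $J_r=J'\setminus(J_l\cup\{\alpha\})$ and $t_\alpha=t+\sum_{j\in J_l}p_j$. If $c_q\le t_\alpha<c_{q+1}$ and $t_\alpha$ lies in none of the banned intervals $[t^*_{\alpha j},c_{\alpha j})$ with $j\in J'\setminus\{\alpha\}$,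 $t^*_{\alpha j}\in(t,t_e)$, then $t_\alpha$ is a possible start time of $\alpha$ and a branch is opened: the algorithm solves $(J_l,t)$ and $(J_r,t_\alpha+p_\alpha)$ recursively and combines the results into the sequence $[\mathrm{seq}_l,\alpha,\mathrm{seq}_r]$ with value $\mathrm{opt}_l+\mathrm{opt}_r+w_\alpha/(p_\alpha+t_\alpha)$. The best branch is returned. Time is counted in unit-cost steps on real numbers (arithmetic operations, comparisons, array accesses, list and control steps). **Theorem.** 1. For every instance the algorithm returns an optimal schedule together with its value $\sum_j w_j/C_j$. 2. There is an absolute constant $C$ such that for every instance with $n\ge1$ jobs the whole computation takes at most $C\,n^2(\log n+K)$ steps; computing and sorting all $t^*_{ij}$ (and $c_{ij}$) takes at most $C\,n^2\log n$ steps if $n\ge 2$; and, after that, for every nonempty job set $J'\subseteq J$ and every $t$, all possible start times of $\alpha$ in the subproblem $(J',t)$ are found in at most $C\,n$ steps. 3. Every branch explored by the algorithm contains a potential schedule: whenever a recursive call opens a branch, there is a potential schedule of all $n$ jobs that agrees with this branch and with all branches leading to that call, where agreeing with a branch means that the jobs of $J_l$, then $\alpha$ at time $t_\alpha$, then the jobs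 of $J_r$ are processed consecutively. -/

import Mathlib

/-! Scheduling side: jobs are the elements of `Fin n`; a (partial) schedule is the list of its jobs in
processing order, processed without idle time from a given start time. -/

namespace Refueling

noncomputable section

/-- Auxiliary function `φ_j(t) = w_j / (p_j (p_j + t))`. -/
def phi {n : ℕ} (w p : Fin n → ℝ) (j : Fin n) (t : ℝ) : ℝ := w j / (p j * (p j + t))

/-- `t*_{ij}`, the time at which `φ_i` and `φ_j` cross (where they do). -/
def tstar {n : ℕ} (w p : Fin n → ℝ) (i j : Fin n) : ℝ :=
  (w j * p i ^ 2 - w i * p j ^ 2) / (w i * p j - w j * p i)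

/-- Start time of job `j` in the schedule `S` that begins at time `t`. -/
def startTime {n : ℕ} (p : Fin n → ℝ) (t : ℝ) (S : List (Fin n)) (j : Fin n) : ℝ :=
  t + ((S.take (S.idxOf j)).map p).sum

/-- Completion time of job `j` in the schedule `S` that begins at time `t`. -/
def completionTime {n : ℕ} (p : Fin n → ℝ) (t : ℝ) (S : List (Fin n)) (j : Fin n) : ℝ :=
  startTime p t S j + p j

/-- The cost `∑ -w_j / C_j` (to be minimised) of the schedule `S` begun at time `t`. -/
def cost {n : ℕ} (w p : Fin n → ℝ) (t : ℝ) (S : List (Fin n)) : ℝ :=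
  (S.map fun j => -w j / completionTime p t S j).sum

/-- Complete schedules: every job occurs exactly once. -/
def IsSchedule {n : ℕ} (S : List (Fin n)) : Prop := S.Perm (List.finRange n)

/-- Optimal solutions of `1 || ∑ w_j (-1/C_j)`. -/
def IsOptimal {n : ℕ} (w p : Fin n → ℝ) (S : List (Fin n)) : Prop :=
  IsSchedule S ∧ ∀ S' : List (Fin n), IsSchedule S' → cost w p 0 S ≤ cost w p 0 S'

/-- The dominance rule: `Rule w p i j I` says that the rule contains `i ≺_{g I} j`. -/
inductive Rule {n : ℕ} (w p : Fin n → ℝ) : Fin n → Fin n → Set ℝ → Prop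
  | first (i j : Fin n) (hw : w i < w j) (h : ∀ t, 0 ≤ t → phi w p j t ≤ phi w p i t) :
      Rule w p i j (Set.Ici 0)
  | second (i j : Fin n) (hw : w i < w j) (h : ∀ t, 0 ≤ t → phi w p i t ≤ phi w p j t) :
      Rule w p j i (Set.Ici 0)
  | early (i j : Fin n) (hw : w i < w j) (h₁ : ¬ ∀ t, 0 ≤ t → phi w p j t ≤ phi w p i t)
      (h₂ : ¬ ∀ t, 0 ≤ t → phi w p i t ≤ phi w p j t) :
      Rule w p i j (Set.Ico 0 (tstar w p i j))
  | late (i j : Fin n) (hw : w i < w j) (h₁ : ¬ ∀ t, 0 ≤ t → phi w p j t ≤ phi w p i t)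
      (h₂ : ¬ ∀ t, 0 ≤ t → phi w p i t ≤ phi w p j t) :
      Rule w p j i (Set.Ici (tstar w p i j))

/-- The schedule `S` begun at time `t` violates `i ≺_{g I} j`: job `j` precedes job `i`, and both
`t_j` and `t_i - p_j` lie in the time interval `I`. -/
def Violates {n : ℕ} (p : Fin n → ℝ) (t : ℝ) (S : List (Fin n)) (i j : Fin n) (I : Set ℝ) : Prop :=
  i ∈ S ∧ j ∈ S ∧ startTime p t S j ≤ startTime p t S i - p j ∧
    startTime p t S j ∈ I ∧ startTime p t S i - p j ∈ I

/-- (Partial) potential schedules: no relation of the dominance rule is violated. -/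
def IsPotential {n : ℕ} (w p : Fin n → ℝ) (t : ℝ) (S : List (Fin n)) : Prop :=
  ∀ i j I, Rule w p i j I → ¬ Violates p t S i j I

/-- `K`, the number of complete potential schedules. -/
def numPotential {n : ℕ} (w p : Fin n → ℝ) : ℕ :=
  Set.ncard {S : List (Fin n) | IsSchedule S ∧ IsPotential w p 0 S}

/-! Computation model: a real RAM with unit costs. A value of `Timed β` is a result together with the
number of elementary steps spent on it. An elementary step is one arithmetic operation or comparison
of two reals, one comparison of two job indices, one access to an array, or one `tick`, which pays for
a function call or a loop iteration together with a bounded number of list constructions and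
decompositions. Programs below manipulate reals, indices and arrays through these operations only. -/

/-- A result together with the number of elementary steps spent on it. -/
structure Timed (β : Type) where
  val : β
  time : ℕ

instance : Monad Timed where
  pure a := ⟨a, 0⟩
  bind x f := ⟨(f x.val).val, x.time + (f x.val).time⟩

def tick : Timed Unit := ⟨(), 1⟩
def addR (a b : ℝ) : Timed ℝ := ⟨a + b, 1⟩
def subR (a b : ℝ) : Timed ℝ := ⟨a - b, 1⟩
def mulR (a b : ℝ) : Timed ℝ := ⟨a * b, 1⟩
def divR (a b : ℝ) : Timed ℝ := ⟨a / b, 1⟩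
def ltR (a b : ℝ) : Timed Bool := ⟨decide (a < b), 1⟩
def leR (a b : ℝ) : Timed Bool := ⟨decide (a ≤ b), 1⟩
def eqR (a b : ℝ) : Timed Bool := ⟨decide (a = b), 1⟩
def eqIdx {n : ℕ} (i j : Fin n) : Timed Bool := ⟨decide (i = j), 1⟩
/-- Arrays of length `n` are functions on `Fin n`. -/
def read {n : ℕ} {β : Type} (a : Fin n → β) (i : Fin n) : Timed β := ⟨a i, 1⟩
def write {n : ℕ} {β : Type} (a : Fin n → β) (i : Fin n) (b : β) : Timed (Fin n → β) :=
  ⟨Function.update a i b, 1⟩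
/-- Fill a new array of length `n`: pay for every entry and for writing it. -/
def fill {n : ℕ} {β : Type} (f : Fin n → Timed β) : Timed (Fin n → β) :=
  ⟨fun i => (f i).val, 1 + ∑ i, ((f i).time + 1)⟩
/-- The list of all `n` jobs. -/
def allJobs (n : ℕ) : Timed (List (Fin n)) := ⟨List.finRange n, n + 1⟩

/-- Select the list elements that pass a test. -/
def select {β : Type} (test : β → Timed Bool) : List β → Timed (List β)
  | [] => do tick; return []
  | a :: l => do
      tick
      let b ← test a
      let r ← select test l
      if b then return a :: r else return r

/-- Concatenation of lists, linear in the length of the first. -/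
def append {β : Type} : List β → List β → Timed (List β)
  | [], l => do tick; return l
  | a :: k, l => do
      tick
      let r ← append k l
      return a :: r

/-- Split a list into two halves. -/
def split {β : Type} : List β → Timed (List β × List β)
  | [] => do tick; return ([], [])
  | a :: l => do
      tick
      let r ← split l
      return (a :: r.2, r.1)

/-- Merge two lists sorted by `key`. -/
def merge {n : ℕ} (key : Fin n → ℝ) : List (Fin n) → List (Fin n) → Timed (List (Fin n))
  | [], l => do tick; return l
  | a :: k, [] => do tick; return a :: k
  | a :: k, b :: l => do
      tick
      let x ← read key a
      let y ← read key b
      if ← leR x y then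
        let r ← merge key k (b :: l)
        return a :: r
      else
        let r ← merge key (a :: k) l
        return b :: r
  termination_by k l => k.length + l.length

/-- Merge sort by `key`. The first argument bounds the recursion depth; the length of the list is
always enough. -/
def mergeSort {n : ℕ} (key : Fin n → ℝ) : ℕ → List (Fin n) → Timed (List (Fin n))
  | 0, l => do tick; return l
  | _ + 1, [] => do tick; return []
  | _ + 1, [a] => do tick; return [a]
  | d + 1, a :: b :: l => do
      tick
      let r ← split (a :: b :: l)
      let x ← mergeSort key d r.1
      let y ← mergeSort key d r.2
      merge key x y

/-! The algorithm. -/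

/-- Compute `φ_j(t)`. -/
def evalPhi {n : ℕ} (w p : Fin n → ℝ) (j : Fin n) (t : ℝ) : Timed ℝ := do
  tick
  let wj ← read w j
  let pj ← read p j
  let s ← addR pj t
  let d ← mulR pj s
  divR wj d

/-- Compute `t*_{ij}`, with the value `0` if its denominator vanishes. -/
def evalCrossing {n : ℕ} (w p : Fin n → ℝ) (i j : Fin n) : Timed ℝ := do
  tick
  let wi ← read w i
  let wj ← read w j
  let pi ← read p i
  let pj ← read p j
  let wipj ← mulR wi pj
  let wjpi ← mulR wj pi
  let den ← subR wipj wjpi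
  if ← eqR den 0 then return 0
  else
    let x ← mulR wjpi pi
    let y ← mulR wipj pj
    let num ← subR x y
    divR num den

/-- The precomputed data: `cross i j = t*_{ij}`, `exit i j = c_{ij} = t*_{ij} + p_j`, and for every
job `i` the lists of all jobs `j` sorted by `t*_{ij}` and by `c_{ij}`. -/
structure Tables (n : ℕ) where
  cross : Fin n → Fin n → ℝ
  exit : Fin n → Fin n → ℝ
  byCross : Fin n → List (Fin n)
  byExit : Fin n → List (Fin n)

/-- Generate and sort all `t*_{ij}` (and all `c_{ij}`). -/
def precompute {n : ℕ} (w p : Fin n → ℝ) : Timed (Tables n) := do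
  tick
  let cross ← fill fun i => fill fun j => evalCrossing w p i j
  let exit ← fill fun i => fill fun j => do
    let row ← read cross i
    let x ← read row j
    let pj ← read p j
    addR x pj
  let byCross ← fill fun i => do
    let row ← read cross i
    let all ← allJobs n
    mergeSort row n all
  let byExit ← fill fun i => do
    let row ← read exit i
    let all ← allJobs n
    mergeSort row n all
  return ⟨cross, exit, byCross, byExit⟩

/-- `t` plus the total processing time of the listed jobs. -/
def sumFrom {n : ℕ} (p : Fin n → ℝ) (t : ℝ) : List (Fin n) → Timed ℝ
  | [] => do tick; return t
  | j :: l => do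
      tick
      let pj ← read p j
      let s ← addR t pj
      sumFrom p s l

/-- A job of `a :: l` with maximum `φ(t)`, ties being broken in favour of the maximum `φ(te)`. -/
def findAlpha {n : ℕ} (w p : Fin n → ℝ) (t te : ℝ) (a : Fin n) : List (Fin n) → Timed (Fin n)
  | [] => do tick; return a
  | j :: l => do
      tick
      let x ← evalPhi w p a t
      let y ← evalPhi w p j t
      if ← ltR x y then findAlpha w p t te j l
      else if ← ltR y x then findAlpha w p t te a l
      else
        let x' ← evalPhi w p a te
        let y' ← evalPhi w p j te
        if ← ltR x' y' then findAlpha w p t te j l else findAlpha w p t te a l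

/-- The Boolean array that marks the listed jobs, starting from the marks `m`. -/
def mark {n : ℕ} (m : Fin n → Bool) : List (Fin n) → Timed (Fin n → Bool)
  | [] => do tick; return m
  | j :: l => do
      tick
      let m' ← write m j true
      mark m' l

/-- Test whether `t*_{αj}` lies in `(t, te)`. -/
def crossesIn {n : ℕ} (T : Tables n) (α : Fin n) (t te : ℝ) (j : Fin n) : Timed Bool := do
  tick
  let row ← read T.cross α
  let x ← read row j
  let b₁ ← ltR t x
  let b₂ ← ltR x te
  return b₁ && b₂

/-- Test whether `c_{αj}` is an interior point of `C_J^α`: `t*_{αj} ∈ (t, te)` and `c_{αj} < te`. -/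
def isBreak {n : ℕ} (T : Tables n) (α : Fin n) (t te : ℝ) (j : Fin n) : Timed Bool := do
  tick
  let b ← crossesIn T α t te j
  let row ← read T.exit α
  let c ← read row j
  let b' ← ltR c te
  return b && b'

/-- A branch: job `α` starts at time `start`, after the jobs of `left` and before those of `right`. -/
structure Branch (n : ℕ) where
  job : Fin n
  start : ℝ
  left : List (Fin n)
  right : List (Fin n)

/-- Sweep over the banned intervals `[t*_{αj}, c_{αj})`, listed by increasing left end: drop those
whose left end is at most `s`, and update the maximum `m` of the right ends of those dropped. -/
def sweep {n : ℕ} (T : Tables n) (α : Fin n) (s : ℝ) :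
    List (Fin n) → ℝ → Timed (List (Fin n) × ℝ)
  | [], m => do tick; return ([], m)
  | j :: l, m => do
      tick
      let row ← read T.cross α
      let x ← read row j
      if ← leR x s then
        let row' ← read T.exit α
        let c ← read row' j
        if ← ltR m c then sweep T α s l c else sweep T α s l m
      else return (j :: l, m)

/-- The loop over the points `c_q` of `C_J^α`. Arguments: the jobs whose `c_{αj}` are still to come, by
increasing `c_{αj}`; the current point `c_q`; the start time `s` of `α` after the jobs of `left`; the
lists `left`, `right`; the state of the sweep over `B_α`, in which `s ∈ B_α` iff `s < m`. -/
def scan {n : ℕ} (p : Fin n → ℝ) (T : Tables n) (α : Fin n) (te : ℝ) :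
    List (Fin n) → ℝ → ℝ → List (Fin n) → List (Fin n) → List (Fin n) → ℝ →
      Timed (List (Branch n))
  | [], c, s, left, right, bans, m => do
      tick
      let r ← sweep T α s bans m
      let b₁ ← leR c s
      let b₂ ← ltR s te
      let b₃ ← ltR s r.2
      if b₁ && b₂ && !b₃ then return [⟨α, s, left, right⟩] else return []
  | j :: l, c, s, left, right, bans, m => do
      tick
      let r ← sweep T α s bans m
      let row ← read T.exit α
      let c' ← read row j
      let b₁ ← leR c s
      let b₂ ← ltR s c'
      let b₃ ← ltR s r.2
      let pj ← read p j
      let s' ← addR s pj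
      let rest ← scan p T α te l c' s' (j :: left) right.tail r.1 r.2
      if b₁ && b₂ && !b₃ then return ⟨α, s, left, right⟩ :: rest else return rest

/-- All possible start times of job `α`, with the corresponding `J_l` and `J_r`, for the job set
`a :: l` started at time `t`. -/
def findStarts {n : ℕ} (w p : Fin n → ℝ) (T : Tables n) (a : Fin n) (l : List (Fin n)) (t : ℝ) :
    Timed (List (Branch n)) := do
  tick
  let te ← sumFrom p t (a :: l)
  let α ← findAlpha w p t te a l
  let m₀ ← fill fun _ => (pure false : Timed Bool)
  let m ← mark m₀ (a :: l)
  let m ← write m α false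
  let rowExit ← read T.byExit α
  let breaks ← select (fun j => do
    let b ← read m j
    let b' ← isBreak T α t te j
    return b && b') rowExit
  let rowCross ← read T.byCross α
  let bans ← select (fun j => do
    let b ← read m j
    let b' ← crossesIn T α t te j
    return b && b') rowCross
  let others ← select (fun j => do
    let b ← eqIdx j α
    let b' ← isBreak T α t te j
    return !b && !b') (a :: l)
  let right ← append breaks others
  scan p T α te breaks t t [] right bans t

/-- The recursive procedure `FastSchedule` on the job set `J` and start time `t`, with the precomputed tables:
returns the optimal `∑ w_j / C_j` and a schedule. The first argument bounds the recursion depth; the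
number of jobs is always enough. -/
def fastSchedule {n : ℕ} (w p : Fin n → ℝ) (T : Tables n) :
    ℕ → List (Fin n) → ℝ → Timed (ℝ × List (Fin n))
  | _, [], _ => do tick; return (0, [])
  | 0, _ :: _, _ => do tick; return (0, [])
  | _ + 1, [j], t => do
      tick
      let wj ← read w j
      let pj ← read p j
      let c ← addR pj t
      let v ← divR wj c
      return (v, [j])
  | d + 1, a :: b :: l, t => do
      tick
      let brs ← findStarts w p T a (b :: l) t
      brs.foldlM (fun (best : ℝ × List (Fin n)) (br : Branch n) => do
        tick
        let wα ← read w br.job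
        let pα ← read p br.job
        let c ← addR pα br.start
        let optL ← fastSchedule w p T d br.left t
        let optR ← fastSchedule w p T d br.right c
        let v₁ ← addR optL.1 optR.1
        let v₂ ← divR wα c
        let v ← addR v₁ v₂
        if ← ltR best.1 v then
          let seq ← append optL.2 (br.job :: optR.2)
          return (v, seq)
        else return best) (0, [])

/-- The whole computation: precomputation, then `FastSchedule` on all jobs from time `0`. -/
def solve {n : ℕ} (w p : Fin n → ℝ) : Timed (ℝ × List (Fin n)) := do
  tick
  let T ← precompute w p
  let all ← allJobs n
  fastSchedule w p T n all 0

/-- The complete schedules on a branch: the jobs of `left`, then `job` at time `start`, then the jobs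
of `right` are processed consecutively. -/
def Branch.schedules {n : ℕ} (p : Fin n → ℝ) (b : Branch n) : Set (List (Fin n)) :=
  {S | startTime p 0 S b.job = b.start ∧ ∃ A L R Z : List (Fin n),
    L.Perm b.left ∧ R.Perm b.right ∧ S = A ++ L ++ b.job :: R ++ Z}

/-- `Explored w p J t Q`: in the run of `FastSchedule` on all jobs from time `0` there is a recursive
call on `(J, t)`, and `Q` is the set of complete schedules that agree with all branches taken on the
way to that call. -/
inductive Explored {n : ℕ} (w p : Fin n → ℝ) :
    List (Fin n) → ℝ → Set (List (Fin n)) → Prop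
  | root : Explored w p (List.finRange n) 0 {S | IsSchedule S}
  | left {a b : Fin n} {l : List (Fin n)} {t : ℝ} {Q : Set (List (Fin n))} {br : Branch n}
      (h : Explored w p (a :: b :: l) t Q)
      (hbr : br ∈ (findStarts w p (precompute w p).val a (b :: l) t).val) :
      Explored w p br.left t (Q ∩ br.schedules p)
  | right {a b : Fin n} {l : List (Fin n)} {t : ℝ} {Q : Set (List (Fin n))} {br : Branch n}
      (h : Explored w p (a :: b :: l) t Q)
      (hbr : br ∈ (findStarts w p (precompute w p).val a (b :: l) t).val) :
      Explored w p br.right (p br.job + br.start) (Q ∩ br.schedules p)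

end

end Refueling

/-!
The pivot `α` maximises `φ` at the start time, so if a best order places `α` at time `t_α`,
exchange arguments determine the jobs before it: moving a job `j` from one side of `α` to the
other pays off according to whether `φ_α` and `φ_j` have crossed, which for a pair of positive
jobs happens at most once, at `t*_{αj}`. Hence some best order agrees with one of the opened
branches, and the recursion is correct by induction on the number of jobs.

Choosing one branch in every call produces a leaf of the recursion. On a branch, the jobs before
and after `α` are consistent with the dominance rule for all pairs that involve or straddle `α`,
so every leaf is a potential schedule; different leaves differ in the start time of some pivot.
Each call has at least one branch, so every branch extends to a leaf, and there are at most `K`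
leaves. A leaf is reached through `O(n)` calls of cost `O(n)` each, whence the bound `n² K` for
the recursion; merge sort of `n` rows gives the `n² log n` of the precomputation.
-/

namespace Refueling

noncomputable section

/-! ### Values of job sequences and the exchange argument -/

section Value

variable {ι : Type*} {w p : ι → ℝ}

/-- The time at which the jobs of `J` are finished if they are processed from time `t` on. -/
def endTime (p : ι → ℝ) (t : ℝ) (J : List ι) : ℝ := t + (J.map p).sum

/-- The value `∑ w_j / C_j` of the jobs processed in the listed order from time `t` on. The sums are
associated as in the code of `fastSchedule`. -/
def value (w p : ι → ℝ) : ℝ → List ι → ℝ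
  | _, [] => 0
  | t, j :: S => w j / (p j + t) + value w p (p j + t) S

@[simp] lemma endTime_nil (t : ℝ) : endTime p t [] = t := by simp [endTime]

@[simp] lemma endTime_cons (t : ℝ) (j : ι) (S : List ι) :
    endTime p t (j :: S) = p j + endTime p t S := by
  simp only [endTime, List.map_cons, List.sum_cons]
  ring

@[simp] lemma endTime_append (t : ℝ) (S T : List ι) :
    endTime p t (S ++ T) = endTime p (endTime p t S) T := by
  simp [endTime, add_assoc]

@[simp] lemma endTime_add (s t : ℝ) (S : List ι) :
    endTime p (s + t) S = s + endTime p t S := by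
  simp [endTime, add_assoc]

lemma endTime_perm {S T : List ι} (h : S.Perm T) (t : ℝ) : endTime p t S = endTime p t T := by
  rw [endTime, endTime, (h.map p).sum_eq]

lemma le_endTime (hp : ∀ j, 0 ≤ p j) (t : ℝ) (S : List ι) : t ≤ endTime p t S :=
  le_add_of_nonneg_right (List.sum_nonneg (by simp [hp]))

lemma lt_endTime (hp : ∀ j, 0 < p j) (t : ℝ) {S : List ι} (hS : S ≠ []) : t < endTime p t S := by
  obtain ⟨j, S, rfl⟩ := List.exists_cons_of_ne_nil hS
  rw [endTime_cons]
  linarith [hp j, le_endTime (fun j => (hp j).le) t S]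

lemma value_append (t : ℝ) (S T : List ι) :
    value w p t (S ++ T) = value w p t S + value w p (endTime p t S) T := by
  induction S generalizing t with
  | nil => simp [value]
  | cons j S ih => simp only [List.cons_append, value, ih, endTime_cons, endTime_add, add_assoc]

lemma value_nonneg (hw : ∀ j, 0 ≤ w j) (hp : ∀ j, 0 ≤ p j) {t : ℝ} (ht : 0 ≤ t) (S : List ι) :
    0 ≤ value w p t S := by
  induction S generalizing t with
  | nil => exact le_rfl
  | cons j S ih =>
    have hjt : 0 ≤ p j + t := add_nonneg (hp j) ht
    exact add_nonneg (div_nonneg (hw j) hjt) (ih hjt)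

lemma value_congr {S T : List ι} (hw : S.map w = T.map w) (hp : S.map p = T.map p) (t : ℝ) :
    value w p t S = value w p t T := by
  induction S generalizing T t with
  | nil => cases T <;> simp_all
  | cons i S ih =>
    cases T with
    | nil => simp at hw
    | cons j T =>
      simp only [List.map_cons, List.cons.injEq] at hw hp
      simp only [value, hw.1, hp.1, ih hw.2 hp.2]

lemma convexOn_add_mul_div {u b c : ℝ} (hu : 0 ≤ u) (hc : 0 < c) (hcb : c ≤ b) :
    ConvexOn ℝ (Set.Ici 0) fun y => (b + y) * (u / (c + y)) := by
  have hinv : ConvexOn ℝ (Set.Ici 0) fun y : ℝ => (c + y) ^ (-1 : ℤ) :=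
    ((convexOn_zpow (𝕜 := ℝ) (-1)).translate_right c).subset
      (fun y (hy : 0 ≤ y) => show 0 < c + y by linarith) (convex_Ici 0)
  refine ((hinv.smul (mul_nonneg hu (sub_nonneg.2 hcb))).add_const u).congr fun y hy => ?_
  have hcy : c + y ≠ 0 := by linarith [Set.mem_Ici.1 hy]
  simp only [Pi.add_apply, smul_eq_mul, zpow_neg_one]
  field_simp
  ring

/-- The factor `b + y` cancels the denominators `b + p_i`, `b + p_j` and `b + p_i + p_j` that the
exchanged jobs contribute to the value of a sequence. -/
lemma convexOn_add_mul_value (hw : ∀ j, 0 ≤ w j) (hp : ∀ j, 0 < p j) {x b : ℝ} (hx : 0 ≤ x)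
    (B : List ι) (hb : endTime p x B ≤ b) :
    ConvexOn ℝ (Set.Ici 0) fun y => (b + y) * value w p (y + x) B := by
  induction B generalizing x with
  | nil => simpa [value] using convexOn_const 0 (convex_Ici 0)
  | cons k B ih =>
    have hk := hp k
    rw [endTime_cons, ← endTime_add] at hb
    refine ((convexOn_add_mul_div (hw k) (add_pos_of_pos_of_nonneg hk hx)
      ((le_endTime (fun j => (hp j).le) _ B).trans hb)).add
        (ih (by positivity) hb)).congr fun y _ => ?_
    simp only [Pi.add_apply, value]
    rw [add_left_comm (p k) y x, add_comm y (p k + x)]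
    ring

/-- `S` has the maximum value among all orders of the jobs of `J` processed from time `t` on. -/
def IsBest (w p : ι → ℝ) (J : List ι) (t : ℝ) (S : List ι) : Prop :=
  S.Perm J ∧ ∀ S' : List ι, S'.Perm J → value w p t S' ≤ value w p t S

lemma exists_isBest (w p : ι → ℝ) (J : List ι) (t : ℝ) : ∃ S, IsBest w p J t S := by
  classical
  obtain ⟨S, hS, hmax⟩ := J.permutations.toFinset.exists_max_image (value w p t) ⟨J, by simp⟩
  exact ⟨S, by simpa using hS, fun T hT => hmax T (by simpa using hT)⟩

variable {J S S' : List ι} {t : ℝ}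

lemma IsBest.of_value_le (h : IsBest w p J t S) (hperm : S'.Perm S)
    (hle : value w p t S ≤ value w p t S') : IsBest w p J t S' :=
  ⟨hperm.trans h.1, fun T hT => (h.2 T hT).trans hle⟩

lemma IsBest.value_infix_le {A B B' Z : List ι} (h : IsBest w p J t (A ++ B ++ Z))
    (hB : B'.Perm B) : value w p (endTime p t A) B' ≤ value w p (endTime p t A) B := by
  have hle := h.2 (A ++ B' ++ Z) (((hB.append_left A).append_right Z).trans h.1)
  simp only [value_append, endTime_append, endTime_perm hB] at hle
  linarith

lemma IsBest.replace_infix {A B B' Z : List ι} (h : IsBest w p J t (A ++ B ++ Z))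
    (hB : B'.Perm B) (hle : value w p (endTime p t A) B ≤ value w p (endTime p t A) B') :
    IsBest w p J t (A ++ B' ++ Z) := by
  refine h.of_value_le ((hB.append_left A).append_right Z) ?_
  simp only [value_append, endTime_append, endTime_perm hB]
  linarith

lemma perm_cons_append_singleton_swap (i j : ι) (B : List ι) :
    (i :: B ++ [j]).Perm (j :: B ++ [i]) := by
  simpa using ((List.perm_append_singleton j B).cons i).trans
    ((List.Perm.swap j i B).trans ((List.perm_append_singleton i B).symm.cons j))

lemma IsBest.swap_identical {A B Z : List ι} {i j : ι}
    (h : IsBest w p J t (A ++ j :: B ++ i :: Z)) (hw : w i = w j) (hp : p i = p j) :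
    IsBest w p J t (A ++ i :: B ++ j :: Z) := by
  have h' : IsBest w p J t (A ++ (j :: B ++ [i]) ++ Z) := by simpa using h
  simpa using h'.replace_infix (perm_cons_append_singleton_swap i j B)
    (value_congr (by simp [hw]) (by simp [hp]) _).ge

end Value

section Exchange

variable {n : ℕ} {w p : Fin n → ℝ} {i j : Fin n}

lemma phi_le_phi_iff (hp : ∀ j, 0 < p j) {t : ℝ} (ht : 0 ≤ t) :
    phi w p j t ≤ phi w p i t ↔ w j * (p i * (p i + t)) ≤ w i * (p j * (p j + t)) := by
  have hi := hp i
  have hj := hp j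
  rw [phi, phi, div_le_div_iff₀ (by positivity) (by positivity)]

lemma exchange_gain_pos_of_lt {u v x y a b : ℝ} (hv : 0 < v) (hx : 0 < x) (ha : 0 ≤ a)
    (hab : a < b) (hxy : x < y) (hb : v * (x * (x + b)) ≤ u * (y * (y + b))) :
    0 < (y - x) * (b + (x + y)) * (u / (x + a) + v / (x + y + a) - v / (y + a) - u / (x + y + b)) +
      x * (b + x) * (u / (x + a) + v / (x + y + b) - v / (y + a) - u / (x + y + b)) := by
  have hy : 0 < y := hx.trans hxy
  have hb0 : 0 < b := ha.trans_lt hab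
  have : 0 < x + a := by positivity
  have : 0 < y + a := by positivity
  have : 0 < x + y + a := by positivity
  have : 0 < x + y + b := by positivity
  have hgain : (y - x) * (b + (x + y)) *
        (u / (x + a) + v / (x + y + a) - v / (y + a) - u / (x + y + b)) +
      x * (b + x) * (u / (x + a) + v / (x + y + b) - v / (y + a) - u / (x + y + b)) =
      (u * (y * (y + b)) - v * (x * (x + b))) * ((b - a + y) / ((x + a) * (x + y + b))) +
        v * x * (y - x) * (b - a) * y / ((y + a) * (x + a) * (x + y + a)) := by
    field_simp
    ring
  rw [hgain]
  have : 0 ≤ u * (y * (y + b)) - v * (x * (x + b)) := sub_nonneg.2 hb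
  have : 0 < b - a := sub_pos.2 hab
  have : 0 < y - x := sub_pos.2 hxy
  positivity

lemma exchange_gain_pos_of_le {u v x y a b : ℝ} (hv : 0 < v) (hy : 0 < y) (ha : 0 ≤ a)
    (hab : a < b) (hyx : y ≤ x) (hφ : v * (x * (x + a)) ≤ u * (y * (y + a)))
    (hne : ¬ (u = v ∧ x = y)) :
    0 < (x - y) * b * (u / (x + b) + v / (x + y + b) - v / (y + a) - u / (x + y + b)) +
      y * (b + x) * (u / (x + a) + v / (x + y + b) - v / (y + a) - u / (x + y + b)) := by
  have hx : 0 < x := hy.trans_le hyx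
  have hb0 : 0 < b := ha.trans_lt hab
  have : 0 < x + a := by positivity
  have : 0 < y + a := by positivity
  have : 0 < x + b := by positivity
  have : 0 < x + y + b := by positivity
  have hgain : (x - y) * b * (u / (x + b) + v / (x + y + b) - v / (y + a) - u / (x + y + b)) +
      y * (b + x) * (u / (x + a) + v / (x + y + b) - v / (y + a) - u / (x + y + b)) =
      (u * (y * (y + a)) - v * (x * (x + a))) *
        (((x - y) * b / (x + b) + (b + x) * (b - a + y) / (x + a)) /
          ((y + a) * (x + y + b))) +
      v * x * (x - y) * x * (b - a) / ((y + a) * (x + y + b) * (x + b)) := by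
    field_simp
    ring
  rw [hgain]
  have : 0 ≤ u * (y * (y + a)) - v * (x * (x + a)) := sub_nonneg.2 hφ
  have : 0 < b - a := sub_pos.2 hab
  rcases hyx.eq_or_lt with rfl | hlt
  · have hvu : v < u := by
      refine lt_of_le_of_ne (le_of_mul_le_mul_right hφ (by positivity)) ?_
      exact fun h => hne ⟨h.symm, rfl⟩
    have hphi_pos : 0 < u * (y * (y + a)) - v * (y * (y + a)) := by
      rw [← sub_mul]
      exact mul_pos (sub_pos.2 hvu) (by positivity)
    have : 0 ≤ y - y := (sub_self y).ge
    positivity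
  · have : 0 < x - y := sub_pos.2 hlt
    positivity

variable {a : ℝ} {B : List (Fin n)}

lemma value_cons_append_singleton (i j : Fin n) (a : ℝ) (B : List (Fin n)) :
    value w p a (j :: B ++ [i]) =
      w j / (p j + a) + value w p (p j + a) B + w i / (p i + p j + endTime p a B) := by
  simp only [value, List.cons_append, value_append, endTime_add, add_zero, ← add_assoc]

lemma value_lt_max_of_lt (hw : ∀ j, 0 < w j) (hp : ∀ j, 0 < p j) (ha : 0 ≤ a) (hB : B ≠ [])
    (hφ : phi w p j (endTime p a B) ≤ phi w p i (endTime p a B)) (hij : p i < p j) :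
    value w p a (j :: B ++ [i]) <
      max (value w p a (i :: B ++ [j])) (value w p a (i :: j :: B)) := by
  have hab : a < endTime p a B := lt_endTime hp a hB
  have hconvex := (convexOn_add_mul_value (fun j => (hw j).le) hp ha B le_rfl).slope_mono_adjacent
    (hp i).le (add_pos (hp i) (hp j)).le hij (lt_add_of_pos_left _ (hp i))
  rw [phi_le_phi_iff hp (ha.trans hab.le)] at hφ
  have hgain := exchange_gain_pos_of_lt (hw j) (hp i) ha hab hij hφ
  have hpi := hp i
  have hpj := hp j
  rw [add_sub_cancel_right, div_le_div_iff₀ (sub_pos.2 hij) hpi] at hconvex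
  by_contra! hle
  obtain ⟨hswap, hinsert⟩ := max_le_iff.1 hle
  rw [value_cons_append_singleton, value_cons_append_singleton, add_comm (p j) (p i)] at hswap
  rw [value_cons_append_singleton, value, value, ← add_assoc (p j), add_comm (p j) (p i)]
    at hinsert
  have hswap' := mul_le_mul_of_nonneg_left hswap
    (mul_nonneg hpi.le (by linarith : 0 ≤ endTime p a B + p i))
  have hinsert' := mul_le_mul_of_nonneg_left hinsert
    (show 0 ≤ (p j - p i) * (endTime p a B + (p i + p j)) from
      mul_nonneg (by linarith) (by linarith))
  linarith

lemma value_lt_max_of_le (hw : ∀ j, 0 < w j) (hp : ∀ j, 0 < p j) (ha : 0 ≤ a) (hB : B ≠ [])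
    (hφ : phi w p j a ≤ phi w p i a) (hij : p j ≤ p i) (hne : ¬ (w i = w j ∧ p i = p j)) :
    value w p a (j :: B ++ [i]) <
      max (value w p a (i :: B ++ [j])) (value w p a (B ++ [i, j])) := by
  have hab : a < endTime p a B := lt_endTime hp a hB
  have hpi := hp i
  have hpj := hp j
  have hconvex : (p i - p j) * ((endTime p a B + p j) * value w p (p j + a) B -
        endTime p a B * value w p a B) ≤ p j * ((endTime p a B + p i) * value w p (p i + a) B -
        (endTime p a B + p j) * value w p (p j + a) B) := by
    rcases hij.eq_or_lt with heq | hlt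
    · simp [heq]
    · have hslope := (convexOn_add_mul_value (fun j => (hw j).le) hp ha B
        le_rfl).slope_mono_adjacent Set.self_mem_Ici hpi.le hpj hlt
      simp only [sub_zero, add_zero, zero_add] at hslope
      rw [div_le_div_iff₀ hpj (sub_pos.2 hlt)] at hslope
      linarith
  rw [phi_le_phi_iff hp ha] at hφ
  have hgain := exchange_gain_pos_of_le (hw j) hpj ha hab hij hφ hne
  by_contra! hle
  obtain ⟨hswap, hinsert⟩ := max_le_iff.1 hle
  rw [value_cons_append_singleton, value_cons_append_singleton, add_comm (p j) (p i)] at hswap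
  rw [value_cons_append_singleton, value_append, value, value, value, add_zero, ← add_assoc (p j),
    add_comm (p j) (p i)] at hinsert
  have hswap' := mul_le_mul_of_nonneg_left hswap
    (mul_nonneg hpj.le (by linarith : 0 ≤ endTime p a B + p i))
  have hinsert' := mul_le_mul_of_nonneg_left hinsert
    (show 0 ≤ (p i - p j) * endTime p a B from mul_nonneg (by linarith) (by linarith))
  linarith

/-- Exchanging `i` and `j` alone need not help; if it does not, moving the longer of the two jobs
next to the other one does. -/
theorem exists_perm_value_lt (hw : ∀ j, 0 < w j) (hp : ∀ j, 0 < p j) (ha : 0 ≤ a) (hB : B ≠ [])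
    (hstart : phi w p j a ≤ phi w p i a)
    (hend : phi w p j (endTime p a B) ≤ phi w p i (endTime p a B))
    (hne : ¬ (w i = w j ∧ p i = p j)) :
    ∃ S : List (Fin n), S.Perm (j :: B ++ [i]) ∧ value w p a (j :: B ++ [i]) < value w p a S := by
  rcases lt_or_ge (p i) (p j) with hij | hij
  · rcases lt_max_iff.1 (value_lt_max_of_lt hw hp ha hB hend hij) with hlt | hlt
    · exact ⟨_, perm_cons_append_singleton_swap i j B, hlt⟩
    · exact ⟨_, (List.perm_append_singleton i (j :: B)).symm, hlt⟩
  · rcases lt_max_iff.1 (value_lt_max_of_le hw hp ha hB hstart hij hne) with hlt | hlt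
    · exact ⟨_, perm_cons_append_singleton_swap i j B, hlt⟩
    · refine ⟨_, ?_, hlt⟩
      simpa using List.perm_append_singleton j (B ++ [i])

lemma value_cons_cons_le_iff (hp : ∀ j, 0 < p j) {t : ℝ} (ht : 0 ≤ t) (S : List (Fin n)) :
    value w p t (i :: j :: S) ≤ value w p t (j :: i :: S) ↔ phi w p i t ≤ phi w p j t := by
  have hpi := hp i
  have hpj := hp j
  have hdiff : value w p t (j :: i :: S) - value w p t (i :: j :: S) =
      (w j * (p i * (p i + t)) - w i * (p j * (p j + t))) /
        ((p i + t) * (p j + t) * (p i + p j + t)) := by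
    simp only [value]
    rw [← add_assoc (p i), ← add_assoc (p j), add_comm (p j) (p i)]
    field_simp
    ring
  rw [← sub_nonneg, hdiff, le_div_iff₀ (by positivity), zero_mul, sub_nonneg, phi_le_phi_iff hp ht]

variable {J A Z : List (Fin n)} {t : ℝ}

lemma IsBest.phi_le_of_adjacent (hp : ∀ j, 0 < p j) (ht : 0 ≤ t)
    (h : IsBest w p J t (A ++ j :: i :: Z)) :
    phi w p i (endTime p t A) ≤ phi w p j (endTime p t A) := by
  have h' : IsBest w p J t (A ++ [j, i] ++ Z) := by simpa using h
  exact (value_cons_cons_le_iff hp (ht.trans (le_endTime (fun j => (hp j).le) t A)) []).1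
    (h'.value_infix_le (List.Perm.swap j i []))

lemma IsBest.swap_adjacent (hp : ∀ j, 0 < p j) (ht : 0 ≤ t)
    (h : IsBest w p J t (A ++ j :: i :: Z))
    (hφ : phi w p j (endTime p t A) ≤ phi w p i (endTime p t A)) :
    IsBest w p J t (A ++ i :: j :: Z) := by
  have h' : IsBest w p J t (A ++ [j, i] ++ Z) := by simpa using h
  simpa using h'.replace_infix (List.Perm.swap j i [])
    ((value_cons_cons_le_iff hp (ht.trans (le_endTime (fun j => (hp j).le) t A)) []).2 hφ)

lemma IsBest.eq_nil_of_phi_le (hw : ∀ j, 0 < w j) (hp : ∀ j, 0 < p j) (ht : 0 ≤ t)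
    (h : IsBest w p J t (A ++ j :: B ++ i :: Z))
    (hstart : phi w p j (endTime p t A) ≤ phi w p i (endTime p t A))
    (hend : phi w p j (endTime p t (A ++ B)) ≤ phi w p i (endTime p t (A ++ B)))
    (hne : ¬ (w i = w j ∧ p i = p j)) : B = [] := by
  by_contra hB
  rw [endTime_append] at hend
  obtain ⟨S, hS, hlt⟩ := exists_perm_value_lt hw hp
    (ht.trans (le_endTime (fun j => (hp j).le) t A)) hB hstart hend hne
  have h' : IsBest w p J t (A ++ (j :: B ++ [i]) ++ Z) := by simpa using h
  exact (h'.value_infix_le hS).not_gt hlt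

end Exchange

/-! ### Results of the subroutines -/

section Values

variable {β γ : Type}

@[simp] lemma val_bind (x : Timed β) (f : β → Timed γ) : (x >>= f).val = (f x.val).val := rfl
@[simp] lemma time_bind (x : Timed β) (f : β → Timed γ) :
    (x >>= f).time = x.time + (f x.val).time := rfl
@[simp] lemma val_pure (a : β) : (pure a : Timed β).val = a := rfl
@[simp] lemma time_pure (a : β) : (pure a : Timed β).time = 0 := rfl
@[simp] lemma val_ite (c : Prop) [Decidable c] (x y : Timed β) :
    (if c then x else y).val = if c then x.val else y.val := apply_ite _ _ _ _
@[simp] lemma time_ite (c : Prop) [Decidable c] (x y : Timed β) :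
    (if c then x else y).time = if c then x.time else y.time := apply_ite _ _ _ _
@[simp] lemma time_tick : tick.time = 1 := rfl
@[simp] lemma val_addR (a b : ℝ) : (addR a b).val = a + b := (rfl)
@[simp] lemma val_subR (a b : ℝ) : (subR a b).val = a - b := (rfl)
@[simp] lemma val_mulR (a b : ℝ) : (mulR a b).val = a * b := (rfl)
@[simp] lemma val_divR (a b : ℝ) : (divR a b).val = a / b := (rfl)
@[simp] lemma val_ltR (a b : ℝ) : (ltR a b).val = decide (a < b) := (rfl)
@[simp] lemma val_leR (a b : ℝ) : (leR a b).val = decide (a ≤ b) := (rfl)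
@[simp] lemma val_eqR (a b : ℝ) : (eqR a b).val = decide (a = b) := (rfl)
@[simp] lemma time_addR (a b : ℝ) : (addR a b).time = 1 := rfl
@[simp] lemma time_subR (a b : ℝ) : (subR a b).time = 1 := rfl
@[simp] lemma time_mulR (a b : ℝ) : (mulR a b).time = 1 := rfl
@[simp] lemma time_divR (a b : ℝ) : (divR a b).time = 1 := rfl
@[simp] lemma time_ltR (a b : ℝ) : (ltR a b).time = 1 := rfl
@[simp] lemma time_leR (a b : ℝ) : (leR a b).time = 1 := rfl
@[simp] lemma time_eqR (a b : ℝ) : (eqR a b).time = 1 := rfl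

variable {n : ℕ}

@[simp] lemma val_eqIdx (i j : Fin n) : (eqIdx i j).val = decide (i = j) := (rfl)
@[simp] lemma time_eqIdx (i j : Fin n) : (eqIdx i j).time = 1 := rfl
@[simp] lemma val_read (a : Fin n → β) (i : Fin n) : (read a i).val = a i := (rfl)
@[simp] lemma time_read (a : Fin n → β) (i : Fin n) : (read a i).time = 1 := rfl
@[simp] lemma val_write (a : Fin n → β) (i : Fin n) (b : β) :
    (write a i b).val = Function.update a i b := rfl
@[simp] lemma time_write (a : Fin n → β) (i : Fin n) (b : β) : (write a i b).time = 1 := rfl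
@[simp] lemma val_fill (f : Fin n → Timed β) : (fill f).val = fun i => (f i).val := (rfl)
@[simp] lemma val_allJobs : (allJobs n).val = List.finRange n := (rfl)
@[simp] lemma time_allJobs : (allJobs n).time = n + 1 := rfl

@[simp] lemma val_select (test : β → Timed Bool) (l : List β) :
    (select test l).val = l.filter fun a => (test a).val := by
  induction l with
  | nil => rfl
  | cons a l ih =>
    simp only [select, val_bind, val_ite, val_pure, ih, List.filter_cons]

@[simp] lemma val_append (k l : List β) : (append k l).val = k ++ l := by
  induction k with
  | nil => rfl
  | cons a k ih => simp [append, ih]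

lemma split_perm (l : List β) : ((split l).val.1 ++ (split l).val.2).Perm l := by
  induction l with
  | nil => exact List.Perm.refl _
  | cons a l ih =>
    simp only [split, val_bind, val_pure, List.cons_append]
    exact (List.perm_append_comm.trans ih).cons a

lemma length_split (l : List β) :
    (split l).val.1.length = (l.length + 1) / 2 ∧ (split l).val.2.length = l.length / 2 := by
  induction l with
  | nil => simp [split]
  | cons a l ih =>
    simp only [split, val_bind, val_pure, List.length_cons, ih.1, ih.2]
    exact ⟨(Nat.add_div_right _ two_pos).symm, trivial⟩

lemma merge_perm (key : Fin n → ℝ) (k l : List (Fin n)) :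
    (merge key k l).val.Perm (k ++ l) := by
  induction k, l using merge.induct with
  | case1 l => simp [merge]
  | case2 a k => simp [merge]
  | case3 a k b l ih_left ih_right =>
    simp only [merge, val_bind, val_ite, val_pure]
    split_ifs
    · exact ih_left.cons a
    · exact (ih_right.cons b).trans List.perm_middle.symm

lemma merge_sorted (key : Fin n → ℝ) {k l : List (Fin n)}
    (hk : k.Pairwise fun x y => key x ≤ key y) (hl : l.Pairwise fun x y => key x ≤ key y) :
    (merge key k l).val.Pairwise fun x y => key x ≤ key y := by
  induction k, l using merge.induct with
  | case1 l => simpa [merge] using hl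
  | case2 a k => simpa [merge] using hk
  | case3 a k b l ih_left ih_right =>
    obtain ⟨hak, hk'⟩ := List.pairwise_cons.1 hk
    obtain ⟨hbl, hl'⟩ := List.pairwise_cons.1 hl
    simp only [merge, val_bind, val_ite, val_pure, val_read, val_leR, decide_eq_true_eq]
    split_ifs with hab
    · refine List.pairwise_cons.2 ⟨fun x hx => ?_, ih_left hk' hl⟩
      rw [(merge_perm key _ _).mem_iff, List.mem_append, List.mem_cons] at hx
      rcases hx with hx | rfl | hx
      · exact hak x hx
      · exact hab
      · exact hab.trans (hbl x hx)
    · rw [not_le] at hab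
      refine List.pairwise_cons.2 ⟨fun x hx => ?_, ih_right hk hl'⟩
      rw [(merge_perm key _ _).mem_iff, List.mem_append, List.mem_cons] at hx
      rcases hx with (rfl | hx) | hx
      · exact hab.le
      · exact hab.le.trans (hak x hx)
      · exact hbl x hx

lemma mergeSort_perm (key : Fin n → ℝ) (d : ℕ) (l : List (Fin n)) :
    (mergeSort key d l).val.Perm l := by
  induction d generalizing l with
  | zero => simp [mergeSort]
  | succ d ih =>
    match l with
    | [] => simp [mergeSort]
    | [a] => simp [mergeSort]
    | a :: b :: l =>
      simp only [mergeSort, val_bind]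
      exact (merge_perm key _ _).trans (((ih _).append (ih _)).trans (split_perm _))

lemma mergeSort_sorted (key : Fin n → ℝ) (d : ℕ) (l : List (Fin n)) (hd : l.length ≤ d) :
    (mergeSort key d l).val.Pairwise fun x y => key x ≤ key y := by
  induction d generalizing l with
  | zero => simp [List.length_eq_zero_iff.1 (Nat.le_zero.1 hd), mergeSort]
  | succ d ih =>
    match l with
    | [] => simp [mergeSort]
    | [a] => simp [mergeSort]
    | a :: b :: l =>
      simp only [mergeSort, val_bind]
      have hsplit := length_split (a :: b :: l)
      simp only [List.length_cons] at hsplit hd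
      exact merge_sorted key (ih _ (by omega)) (ih _ (by omega))

@[simp] lemma val_sumFrom (p : Fin n → ℝ) (t : ℝ) (l : List (Fin n)) :
    (sumFrom p t l).val = endTime p t l := by
  induction l generalizing t with
  | nil => simp [sumFrom]
  | cons a l ih => simp [sumFrom, ih, add_comm t]

@[simp] lemma val_mark (m : Fin n → Bool) (l : List (Fin n)) (j : Fin n) :
    (mark m l).val j = (m j || decide (j ∈ l)) := by
  induction l generalizing m with
  | nil => simp [mark]
  | cons a l ih =>
    simp only [mark, val_bind, ih, val_write, List.mem_cons]
    by_cases h : j = a <;> simp [h, Function.update]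

@[simp] lemma val_evalPhi (w p : Fin n → ℝ) (j : Fin n) (t : ℝ) :
    (evalPhi w p j t).val = phi w p j t := rfl

@[simp] lemma val_evalCrossing (w p : Fin n → ℝ) (i j : Fin n) :
    (evalCrossing w p i j).val = tstar w p i j := by
  simp only [evalCrossing, val_bind, val_ite, val_pure, val_read, val_subR, val_mulR, val_divR,
    val_eqR, decide_eq_true_eq, tstar]
  split_ifs with h
  · rw [h, div_zero]
  · ring_nf

/-- The key `(φ_j(t), φ_j(t_e))`, ordered lexicographically, that the job `α` of a subproblem
maximises. -/
def phiKey (w p : Fin n → ℝ) (t te : ℝ) (j : Fin n) : ℝ ×ₗ ℝ := toLex (phi w p j t, phi w p j te)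

lemma phiKey_le_phiKey {w p : Fin n → ℝ} {t te : ℝ} {i j : Fin n} :
    phiKey w p t te j ≤ phiKey w p t te i ↔
      phi w p j t < phi w p i t ∨ phi w p j t = phi w p i t ∧ phi w p j te ≤ phi w p i te :=
  Prod.Lex.toLex_le_toLex

lemma val_findAlpha_cons (w p : Fin n → ℝ) (t te : ℝ) (a j : Fin n) (l : List (Fin n)) :
    (findAlpha w p t te a (j :: l)).val =
      (findAlpha w p t te (if phiKey w p t te a < phiKey w p t te j then j else a) l).val := by
  simp only [findAlpha, val_bind, val_ite, val_evalPhi, val_ltR, decide_eq_true_eq, phiKey,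
    Prod.Lex.toLex_lt_toLex]
  grind

lemma findAlpha_mem (w p : Fin n → ℝ) (t te : ℝ) (a : Fin n) (l : List (Fin n)) :
    (findAlpha w p t te a l).val ∈ a :: l := by
  induction l generalizing a with
  | nil => simp [findAlpha]
  | cons j l ih =>
    rw [val_findAlpha_cons]
    split_ifs
    · exact List.mem_cons_of_mem _ (ih j)
    · exact List.cons_subset_cons a (List.subset_cons_self j l) (ih a)

lemma phiKey_le_findAlpha (w p : Fin n → ℝ) (t te : ℝ) {a j : Fin n} {l : List (Fin n)}
    (hj : j ∈ a :: l) : phiKey w p t te j ≤ phiKey w p t te (findAlpha w p t te a l).val := by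
  induction l generalizing a j with
  | nil => simp_all [findAlpha]
  | cons k l ih =>
    rw [val_findAlpha_cons]
    rw [List.mem_cons, List.mem_cons] at hj
    split_ifs with hlt <;> rcases hj with rfl | rfl | hj
    · exact hlt.le.trans (ih List.mem_cons_self)
    · exact ih List.mem_cons_self
    · exact ih (List.mem_cons_of_mem _ hj)
    · exact ih List.mem_cons_self
    · exact (not_lt.1 hlt).trans (ih List.mem_cons_self)
    · exact ih (List.mem_cons_of_mem _ hj)

@[simp] lemma precompute_cross (w p : Fin n → ℝ) : (precompute w p).val.cross = tstar w p := by
  simp [precompute]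

@[simp] lemma precompute_exit (w p : Fin n → ℝ) (i j : Fin n) :
    (precompute w p).val.exit i j = tstar w p i j + p j := by
  simp [precompute]

lemma precompute_byCross (w p : Fin n → ℝ) (i : Fin n) :
    (precompute w p).val.byCross i = (mergeSort (tstar w p i) n (List.finRange n)).val := by
  simp [precompute]

lemma precompute_byExit (w p : Fin n → ℝ) (i : Fin n) : (precompute w p).val.byExit i =
    (mergeSort (fun j => tstar w p i j + p j) n (List.finRange n)).val := by
  simp [precompute]

@[simp] lemma val_crossesIn (T : Tables n) (α : Fin n) (t te : ℝ) (j : Fin n) :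
    (crossesIn T α t te j).val = (decide (t < T.cross α j) && decide (T.cross α j < te)) := rfl

@[simp] lemma val_isBreak (T : Tables n) (α : Fin n) (t te : ℝ) (j : Fin n) :
    (isBreak T α t te j).val = ((decide (t < T.cross α j) && decide (T.cross α j < te)) &&
      decide (T.exit α j < te)) := rfl

end Values

section Scan

variable {n : ℕ} {p : Fin n → ℝ} {T : Tables n} {α : Fin n} {te : ℝ}

/-- The start times excluded by a state `(bans, m)` of the sweep. -/
def bannedTimes (T : Tables n) (α : Fin n) (bans : List (Fin n)) (m : ℝ) : Set ℝ :=
  {s | s < m ∨ ∃ j ∈ bans, s ∈ Set.Ico (T.cross α j) (T.exit α j)}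

lemma val_sweep_cons (T : Tables n) (α : Fin n) (s : ℝ) (j : Fin n) (l : List (Fin n)) (m : ℝ) :
    (sweep T α s (j :: l) m).val =
      if T.cross α j ≤ s then (sweep T α s l (max m (T.exit α j))).val else (j :: l, m) := by
  simp only [sweep, val_bind, val_ite, val_read, val_leR, val_ltR, val_pure, decide_eq_true_eq]
  split_ifs with _ hlt
  · rw [max_eq_right hlt.le]
  · rw [max_eq_left (not_lt.1 hlt)]
  · rfl

lemma sweep_suffix (T : Tables n) (α : Fin n) (s : ℝ) (bans : List (Fin n)) (m : ℝ) :
    (sweep T α s bans m).val.1 <:+ bans := by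
  induction bans generalizing m with
  | nil => simp [sweep]
  | cons j l ih =>
    rw [val_sweep_cons]
    split_ifs
    · exact (ih _).trans (List.suffix_cons j l)
    · exact List.suffix_rfl

lemma lt_cross_of_mem_sweep {bans : List (Fin n)}
    (hbans : bans.Pairwise fun x y => T.cross α x ≤ T.cross α y) {s m : ℝ} {j : Fin n}
    (hj : j ∈ (sweep T α s bans m).val.1) : s < T.cross α j := by
  induction bans generalizing m with
  | nil => simp [sweep] at hj
  | cons i l ih =>
    obtain ⟨hil, hl⟩ := List.pairwise_cons.1 hbans
    rw [val_sweep_cons] at hj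
    split_ifs at hj with hcross
    · exact ih hl hj
    · rcases List.mem_cons.1 hj with rfl | hj
      · exact not_le.1 hcross
      · exact (not_le.1 hcross).trans_le (hil j hj)

lemma mem_bannedTimes_sweep {s s' : ℝ} (hs : s ≤ s') (bans : List (Fin n)) (m : ℝ) :
    s' ∈ bannedTimes T α (sweep T α s bans m).val.1 (sweep T α s bans m).val.2 ↔
      s' ∈ bannedTimes T α bans m := by
  induction bans generalizing m with
  | nil => simp [sweep]
  | cons j l ih =>
    rw [val_sweep_cons]
    split_ifs with hcross
    · rw [ih]
      simp only [bannedTimes, Set.mem_ofPred_eq, lt_max_iff, List.mem_cons, exists_eq_or_imp,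
        Set.mem_Ico, hcross.trans hs, true_and, or_assoc]
    · rfl

lemma lt_sweep_iff {s : ℝ} {bans : List (Fin n)}
    (hbans : bans.Pairwise fun x y => T.cross α x ≤ T.cross α y) (m : ℝ) :
    s < (sweep T α s bans m).val.2 ↔ s ∈ bannedTimes T α bans m := by
  rw [← mem_bannedTimes_sweep le_rfl bans m]
  refine ⟨Or.inl, ?_⟩
  rintro (hlt | ⟨j, hj, hcross, -⟩)
  · exact hlt
  · exact absurd (lt_cross_of_mem_sweep hbans hj) hcross.not_gt

lemma mem_scan_nil {c s m : ℝ} {left right bans : List (Fin n)} {br : Branch n}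
    (hbans : bans.Pairwise fun x y => T.cross α x ≤ T.cross α y) :
    br ∈ (scan p T α te [] c s left right bans m).val ↔
      br = ⟨α, s, left, right⟩ ∧ c ≤ s ∧ s < te ∧ s ∉ bannedTimes T α bans m := by
  rw [← lt_sweep_iff hbans]
  simp only [scan, val_bind, val_ite, val_pure, val_leR, val_ltR, Bool.and_eq_true,
    decide_eq_true_eq, Bool.not_eq_true', decide_eq_false_iff_not]
  split_ifs with h
  · simp [h]
  · rw [List.mem_nil_iff]
    grind

lemma mem_scan_cons {c s m : ℝ} {j : Fin n} {bs left right bans : List (Fin n)} {br : Branch n}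
    (hbans : bans.Pairwise fun x y => T.cross α x ≤ T.cross α y) :
    br ∈ (scan p T α te (j :: bs) c s left right bans m).val ↔
      (br = ⟨α, s, left, right⟩ ∧ c ≤ s ∧ s < T.exit α j ∧ s ∉ bannedTimes T α bans m) ∨
      br ∈ (scan p T α te bs (T.exit α j) (s + p j) (j :: left) right.tail
        (sweep T α s bans m).val.1 (sweep T α s bans m).val.2).val := by
  rw [← lt_sweep_iff hbans]
  simp only [scan, val_bind, val_ite, val_pure, val_leR, val_ltR, val_read, val_addR,
    Bool.and_eq_true, decide_eq_true_eq, Bool.not_eq_true', decide_eq_false_iff_not]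
  split_ifs with h
  · rw [List.mem_cons]; grind
  · grind

/-- `br` is the branch that `scan`, in a state with the given data, opens after it has moved the
jobs of `k₁` to the left, with the jobs of `k₂` still to come. -/
structure IsScanned (p : Fin n → ℝ) (T : Tables n) (α : Fin n) (te c s : ℝ)
    (left right bans : List (Fin n)) (m : ℝ) (k₁ k₂ : List (Fin n)) (br : Branch n) : Prop where
  eq : br = ⟨α, endTime p s k₁, k₁.reverse ++ left, right.drop k₁.length⟩
  le_start : c ≤ br.start
  exit_le_start : ∀ j ∈ k₁, T.exit α j ≤ br.start
  start_lt_exit : ∀ j ∈ k₂, br.start < T.exit α j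
  start_lt : br.start < te
  start_notMem : br.start ∉ bannedTimes T α bans m

variable {c s m : ℝ} {left right bans : List (Fin n)} {br : Branch n}

lemma isScanned_nil_iff {k : List (Fin n)} :
    IsScanned p T α te c s left right bans m [] k br ↔
      br = ⟨α, s, left, right⟩ ∧ c ≤ s ∧ (∀ j ∈ k, s < T.exit α j) ∧ s < te ∧
        s ∉ bannedTimes T α bans m := by
  constructor
  · rintro ⟨hbr, hc, -, hk, hte, hban⟩
    obtain rfl : br = ⟨α, s, left, right⟩ := by simpa using hbr
    exact ⟨rfl, hc, hk, hte, hban⟩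
  · rintro ⟨rfl, hc, hk, hte, hban⟩
    exact ⟨by simp, hc, by simp, hk, hte, hban⟩

lemma isScanned_cons_iff (hp : ∀ j, 0 < p j) {j : Fin n} {k₁ k₂ : List (Fin n)}
    (hc : c ≤ T.exit α j) :
    IsScanned p T α te c s left right bans m (j :: k₁) k₂ br ↔
      IsScanned p T α te (T.exit α j) (s + p j) (j :: left) right.tail
        (sweep T α s bans m).val.1 (sweep T α s bans m).val.2 k₁ k₂ br := by
  have heq : (⟨α, endTime p s (j :: k₁), (j :: k₁).reverse ++ left,
      right.drop (j :: k₁).length⟩ : Branch n) =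
      ⟨α, endTime p (s + p j) k₁, k₁.reverse ++ j :: left, right.tail.drop k₁.length⟩ := by
    simp [add_comm s]
  have hs : s ≤ endTime p (s + p j) k₁ :=
    (le_add_of_nonneg_right (hp j).le).trans (le_endTime (fun j => (hp j).le) _ k₁)
  constructor
  · rintro ⟨hbr, -, hk₁, hk₂, hte, hban⟩
    rw [heq] at hbr
    rw [List.forall_mem_cons] at hk₁
    exact ⟨hbr, hk₁.1, hk₁.2, hk₂, hte,
      (mem_bannedTimes_sweep (by rwa [hbr]) bans m).not.2 hban⟩
  · rintro ⟨hbr, hexit, hk₁, hk₂, hte, hban⟩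
    exact ⟨hbr.trans heq.symm, hc.trans hexit, List.forall_mem_cons.2 ⟨hexit, hk₁⟩, hk₂, hte,
      (mem_bannedTimes_sweep (by rwa [hbr]) bans m).not.1 hban⟩

lemma mem_scan_iff (hp : ∀ j, 0 < p j) {bs : List (Fin n)}
    (hbans : bans.Pairwise fun x y => T.cross α x ≤ T.cross α y)
    (hbs : bs.Pairwise fun x y => T.exit α x ≤ T.exit α y)
    (hte : ∀ j ∈ bs, T.exit α j < te) (hc : ∀ j ∈ bs, c ≤ T.exit α j) :
    br ∈ (scan p T α te bs c s left right bans m).val ↔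
      ∃ k₁ k₂, bs = k₁ ++ k₂ ∧ IsScanned p T α te c s left right bans m k₁ k₂ br := by
  induction bs generalizing c s left right bans m with
  | nil => simp [mem_scan_nil hbans, isScanned_nil_iff, eq_comm (a := ([] : List (Fin n))),
      List.append_eq_nil_iff]
  | cons j bs ih =>
    obtain ⟨hj, hbs'⟩ := List.pairwise_cons.1 hbs
    rw [List.forall_mem_cons] at hte hc
    have hfirst : (∀ i ∈ j :: bs, s < T.exit α i) ∧ s < te ↔ s < T.exit α j := by
      rw [List.forall_mem_cons]
      exact ⟨fun h => h.1.1, fun h => ⟨⟨h, fun i hi => h.trans_le (hj i hi)⟩, h.trans hte.1⟩⟩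
    rw [mem_scan_cons hbans, ih (hbans.sublist (sweep_suffix T α s bans m).sublist) hbs' hte.2 hj]
    constructor
    · rintro (⟨rfl, hcs, hexit, hban⟩ | ⟨k₁, k₂, rfl, h⟩)
      · obtain ⟨hall, hste⟩ := hfirst.2 hexit
        exact ⟨[], j :: bs, rfl, isScanned_nil_iff.2 ⟨rfl, hcs, hall, hste, hban⟩⟩
      · exact ⟨j :: k₁, k₂, rfl, (isScanned_cons_iff hp hc.1).2 h⟩
    · rintro ⟨_ | ⟨i, k₁⟩, k₂, hsplit, h⟩
      · obtain rfl : j :: bs = k₂ := hsplit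
        obtain ⟨rfl, hcs, hall, hste, hban⟩ := isScanned_nil_iff.1 h
        exact Or.inl ⟨rfl, hcs, hfirst.1 ⟨hall, hste⟩, hban⟩
      · obtain ⟨rfl, rfl⟩ := List.cons.inj hsplit
        exact Or.inr ⟨k₁, k₂, rfl, (isScanned_cons_iff hp hc.1).1 h⟩

lemma le_start_of_mem_scan (hp : ∀ j, 0 ≤ p j) {bs : List (Fin n)}
    (hbr : br ∈ (scan p T α te bs c s left right bans m).val) : s ≤ br.start := by
  induction bs generalizing c s left right bans m with
  | nil =>
    simp only [scan, val_bind, val_ite, val_pure] at hbr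
    split_ifs at hbr <;> simp_all
  | cons j bs ih =>
    have hs : s ≤ s + p j := le_add_of_nonneg_right (hp j)
    simp only [scan, val_bind, val_ite, val_pure] at hbr
    split_ifs at hbr
    · rcases List.mem_cons.1 hbr with rfl | hbr
      · exact le_rfl
      · exact hs.trans (ih hbr)
    · exact hs.trans (ih hbr)

lemma scan_pairwise (hp : ∀ j, 0 < p j) (bs : List (Fin n)) :
    (scan p T α te bs c s left right bans m).val.Pairwise fun b b' => b.start < b'.start := by
  induction bs generalizing c s left right bans m with
  | nil =>
    simp only [scan, val_bind, val_ite, val_pure]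
    split_ifs <;> simp
  | cons j bs ih =>
    simp only [scan, val_bind, val_ite, val_pure]
    split_ifs
    · exact List.pairwise_cons.2 ⟨fun br hbr => (lt_add_of_pos_right s (hp j)).trans_le
        (le_start_of_mem_scan (fun j => (hp j).le) hbr), ih⟩
    · exact ih

end Scan

/-! ### The branches of a subproblem -/

section FindStarts

variable {n : ℕ}

/-- The job `α` that `FastSchedule` selects for the job set `a :: l` at time `t`. -/
def pivot (w p : Fin n → ℝ) (a : Fin n) (l : List (Fin n)) (t : ℝ) : Fin n :=
  (findAlpha w p t (endTime p t (a :: l)) a l).val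

/-- The functions `φ_α` and `φ_j` cross within a subproblem that begins at `t` and ends at `te`. -/
def Crosses (w p : Fin n → ℝ) (t te : ℝ) (α j : Fin n) : Prop := tstar w p α j ∈ Set.Ioo t te

/-- The point `c_{αj}` is an interior point of the list `c_1, c_2, …` of the subproblem. -/
def Breaks (w p : Fin n → ℝ) (t te : ℝ) (α j : Fin n) : Prop :=
  Crosses w p t te α j ∧ tstar w p α j + p j < te

/-- Processing the jobs of `L`, then `α`, then the jobs of `R` from time `t` on obeys all relations
between `α` and the other jobs that the algorithm takes into account: the start time of `α` is
neither too early for the jobs of `L` nor too late for those of `R`. -/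
structure Conforming (w p : Fin n → ℝ) (t : ℝ) (α : Fin n) (L R : List (Fin n)) : Prop where
  left : ∀ j ∈ L, Crosses w p t (endTime p t (L ++ α :: R)) α j ∧
    tstar w p α j + p j ≤ endTime p t L
  right : ∀ j ∈ R, Crosses w p t (endTime p t (L ++ α :: R)) α j →
    endTime p t L < tstar w p α j

open Classical in
/-- The jobs of `J` with a break point for `α`, in the order in which `scan` meets them. -/
def breakJobs (w p : Fin n → ℝ) (t : ℝ) (α : Fin n) (J : List (Fin n)) : List (Fin n) :=
  ((precompute w p).val.byExit α).filter fun j => j ∈ J ∧ j ≠ α ∧ Breaks w p t (endTime p t J) α j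

open Classical in
/-- The jobs of `J` with a banned interval for `α`, in the order in which `sweep` meets them. -/
def banJobs (w p : Fin n → ℝ) (t : ℝ) (α : Fin n) (J : List (Fin n)) : List (Fin n) :=
  ((precompute w p).val.byCross α).filter fun j =>
    j ∈ J ∧ j ≠ α ∧ Crosses w p t (endTime p t J) α j

open Classical in
/-- The jobs of `J` that can only be processed after `α`. -/
def otherJobs (w p : Fin n → ℝ) (t : ℝ) (α : Fin n) (J : List (Fin n)) : List (Fin n) :=
  J.filter fun j => j ≠ α ∧ ¬ Breaks w p t (endTime p t J) α j

variable {w p : Fin n → ℝ} {t : ℝ} {α j a : Fin n} {J L R l : List (Fin n)}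

lemma pivot_mem (w p : Fin n → ℝ) (a : Fin n) (l : List (Fin n)) (t : ℝ) :
    pivot w p a l t ∈ a :: l :=
  findAlpha_mem w p t _ a l

lemma phiKey_le_pivot (t : ℝ) (hj : j ∈ a :: l) :
    phiKey w p t (endTime p t (a :: l)) j ≤
      phiKey w p t (endTime p t (a :: l)) (pivot w p a l t) :=
  phiKey_le_findAlpha w p t _ hj

lemma Conforming.of_perm {L' R' : List (Fin n)} (h : Conforming w p t α L R) (hL : L.Perm L')
    (hR : R.Perm R') : Conforming w p t α L' R' := by
  have hend := endTime_perm (p := p) (hL.append (hR.cons α)) t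
  constructor
  · simpa only [hL.mem_iff, endTime_perm hL, hend] using h.left
  · simpa only [hR.mem_iff, endTime_perm hL, hend] using h.right

@[simp] lemma mem_breakJobs :
    j ∈ breakJobs w p t α J ↔ j ∈ J ∧ j ≠ α ∧ Breaks w p t (endTime p t J) α j := by
  simp [breakJobs, precompute_byExit, (mergeSort_perm _ _ _).mem_iff]

@[simp] lemma mem_banJobs :
    j ∈ banJobs w p t α J ↔ j ∈ J ∧ j ≠ α ∧ Crosses w p t (endTime p t J) α j := by
  simp [banJobs, precompute_byCross, (mergeSort_perm _ _ _).mem_iff]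

@[simp] lemma mem_otherJobs :
    j ∈ otherJobs w p t α J ↔ j ∈ J ∧ j ≠ α ∧ ¬ Breaks w p t (endTime p t J) α j := by
  simp [otherJobs]

lemma breakJobs_pairwise (w p : Fin n → ℝ) (t : ℝ) (α : Fin n) (J : List (Fin n)) :
    (breakJobs w p t α J).Pairwise fun i j =>
      (precompute w p).val.exit α i ≤ (precompute w p).val.exit α j := by
  simp only [precompute_exit, breakJobs, precompute_byExit]
  exact (mergeSort_sorted _ _ _ (by simp)).filter _

lemma banJobs_pairwise (w p : Fin n → ℝ) (t : ℝ) (α : Fin n) (J : List (Fin n)) :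
    (banJobs w p t α J).Pairwise fun i j =>
      (precompute w p).val.cross α i ≤ (precompute w p).val.cross α j := by
  simp only [precompute_cross, banJobs, precompute_byCross]
  exact (mergeSort_sorted _ _ _ (by simp)).filter _

lemma breakJobs_nodup (w p : Fin n → ℝ) (t : ℝ) (α : Fin n) (J : List (Fin n)) :
    (breakJobs w p t α J).Nodup := by
  rw [breakJobs, precompute_byExit]
  exact ((mergeSort_perm _ _ _).nodup_iff.2 (List.nodup_finRange n)).filter _

lemma cons_breakJobs_append_otherJobs_perm (hJ : J.Nodup) (hα : α ∈ J) :
    (α :: (breakJobs w p t α J ++ otherJobs w p t α J)).Perm J := by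
  rw [List.perm_ext_iff_of_nodup _ hJ]
  · intro j
    by_cases hj : j = α
    · simp [hj, hα]
    · simp only [List.mem_cons, List.mem_append, mem_breakJobs, mem_otherJobs]
      tauto
  · refine List.nodup_cons.2 ⟨by simp, (breakJobs_nodup w p t α J).append (hJ.filter _) ?_⟩
    intro j hbreak hother
    exact (mem_otherJobs.1 hother).2.2 (mem_breakJobs.1 hbreak).2.2

lemma val_findStarts (w p : Fin n → ℝ) (a : Fin n) (l : List (Fin n)) (t : ℝ) :
    (findStarts w p (precompute w p).val a l t).val =
      (scan p (precompute w p).val (pivot w p a l t) (endTime p t (a :: l))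
        (breakJobs w p t (pivot w p a l t) (a :: l)) t t []
        (breakJobs w p t (pivot w p a l t) (a :: l) ++ otherJobs w p t (pivot w p a l t) (a :: l))
        (banJobs w p t (pivot w p a l t) (a :: l)) t).val := by
  have hmark (j : Fin n) : Function.update (mark (fun _ => false) (a :: l)).val (pivot w p a l t)
      false j = decide (j ∈ a :: l ∧ j ≠ pivot w p a l t) := by
    by_cases h : j = pivot w p a l t
    · simp [h]
    · simp [h]
  simp only [findStarts, val_bind, val_sumFrom, val_append, val_select, val_fill, val_write,
    val_read, val_pure, val_crossesIn, val_isBreak, val_eqIdx, precompute_cross, precompute_exit]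
  rw [← pivot]
  simp only [hmark, breakJobs, banJobs, otherJobs, Breaks, Crosses, Set.mem_Ioo,
    ← Bool.decide_and, ← decide_not, and_assoc]

/-- The branches that the algorithm opens for the job set `a :: l` at time `t`. -/
structure IsBranch (w p : Fin n → ℝ) (a : Fin n) (l : List (Fin n)) (t : ℝ) (br : Branch n) :
    Prop where
  job_eq : br.job = pivot w p a l t
  start_eq : br.start = endTime p t br.left
  perm : (br.left ++ br.job :: br.right).Perm (a :: l)
  conforming : Conforming w p t br.job br.left br.right

variable {br : Branch n}

lemma mem_findStarts_iff (hp : ∀ j, 0 < p j) :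
    br ∈ (findStarts w p (precompute w p).val a l t).val ↔
      ∃ k₁ k₂, breakJobs w p t (pivot w p a l t) (a :: l) = k₁ ++ k₂ ∧
        IsScanned p (precompute w p).val (pivot w p a l t) (endTime p t (a :: l)) t t []
          (breakJobs w p t (pivot w p a l t) (a :: l) ++
            otherJobs w p t (pivot w p a l t) (a :: l))
          (banJobs w p t (pivot w p a l t) (a :: l)) t k₁ k₂ br := by
  rw [val_findStarts]
  refine mem_scan_iff hp (banJobs_pairwise ..) (breakJobs_pairwise ..) ?_ ?_
  · intro j hj
    rw [precompute_exit]
    exact (mem_breakJobs.1 hj).2.2.2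
  · intro j hj
    rw [precompute_exit]
    exact ((mem_breakJobs.1 hj).2.2.1.1.trans (lt_add_of_pos_right _ (hp j))).le

lemma notMem_bannedTimes_iff {bans : List (Fin n)} {m s : ℝ} :
    s ∉ bannedTimes (precompute w p).val α bans m ↔
      m ≤ s ∧ ∀ j ∈ bans, tstar w p α j ≤ s → tstar w p α j + p j ≤ s := by
  simp [bannedTimes]

lemma isBranch_of_mem_findStarts (hp : ∀ j, 0 < p j) (hnd : (a :: l).Nodup)
    (hbr : br ∈ (findStarts w p (precompute w p).val a l t).val) : IsBranch w p a l t br := by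
  obtain ⟨k₁, k₂, hbreak, hscan⟩ := (mem_findStarts_iff hp).1 hbr
  have hperm := cons_breakJobs_append_otherJobs_perm (w := w) (p := p) (t := t) hnd
    (pivot_mem w p a l t)
  obtain ⟨heq, -, hexit, hpending, hlt, hban⟩ := hscan
  obtain ⟨hjob, hstart, hleft, hright⟩ : br.job = pivot w p a l t ∧
      br.start = endTime p t br.left ∧ br.left = k₁.reverse ∧
      br.right = k₂ ++ otherJobs w p t (pivot w p a l t) (a :: l) := by
    simp [heq, hbreak, endTime_perm (List.reverse_perm k₁)]
  have hperm' : (br.left ++ br.job :: br.right).Perm (a :: l) := by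
    rw [hbreak, List.append_assoc] at hperm
    rw [hleft, hright, hjob]
    exact ((List.reverse_perm k₁).append_right _).trans (List.perm_middle.trans hperm)
  refine ⟨hjob, hstart, hperm', ?_, ?_⟩ <;> rw [endTime_perm hperm', ← hstart, hjob]
  · intro j hj
    have hj' : j ∈ k₁ := by simpa [hleft] using hj
    exact ⟨(mem_breakJobs.1 (hbreak ▸ List.mem_append_left k₂ hj')).2.2.1,
      by simpa using hexit j hj'⟩
  · intro j hj hcross
    by_contra! hle
    have hmem : j ∈ a :: l := hperm'.mem_iff.1 (by simp [hj])
    have hne : j ≠ pivot w p a l t := by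
      rintro rfl
      have := (List.nodup_append.1 (hperm'.nodup_iff.2 hnd)).2.1
      simp_all
    have hexit_le := (notMem_bannedTimes_iff.1 hban).2 j
      (mem_banJobs.2 ⟨hmem, hne, hcross⟩) hle
    rw [hright, List.mem_append, mem_otherJobs] at hj
    rcases hj with hj | ⟨-, -, hj⟩
    · exact absurd (hpending j hj) (by simpa using hexit_le)
    · exact hj ⟨hcross, hexit_le.trans_lt hlt⟩

lemma eq_filter_append_filter {β : Type*} {key : β → ℝ} {l : List β}
    (hl : l.Pairwise fun x y => key x ≤ key y) (s : ℝ) :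
    l = (l.filter fun j => key j ≤ s) ++ l.filter fun j => ¬ key j ≤ s := by
  induction l with
  | nil => rfl
  | cons j l ih =>
    obtain ⟨hjl, hl'⟩ := List.pairwise_cons.1 hl
    by_cases hj : key j ≤ s
    · simpa [List.filter_cons, hj] using ih hl'
    · have hall : ∀ i ∈ l, s < key i := fun i hi => (not_le.1 hj).trans_le (hjl i hi)
      have hnil : l.filter (fun j => key j ≤ s) = [] := by simpa using hall
      have hself : l.filter (fun j => ¬ key j ≤ s) = l := by simpa using hall
      simp only [List.filter_cons, hj, hnil, hself]
      simp

lemma Conforming.filter_breakJobs_perm (hp : ∀ j, 0 < p j) (hJ : J.Nodup)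
    (hperm : (L ++ α :: R).Perm J) (hconf : Conforming w p t α L R) :
    ((breakJobs w p t α J).filter fun j => tstar w p α j + p j ≤ endTime p t L).Perm L := by
  have hnd : (L ++ α :: R).Nodup := hperm.nodup_iff.2 hJ
  rw [List.perm_ext_iff_of_nodup ((breakJobs_nodup w p t α J).filter _) hnd.of_append_left]
  intro j
  rw [List.mem_filter, mem_breakJobs, decide_eq_true_eq, ← hperm.mem_iff, ← endTime_perm hperm]
  constructor
  · rintro ⟨⟨hj, hne, hcross, -⟩, hexit⟩
    have hj' : j ∈ L ∨ j ∈ R := by simpa [hne] using hj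
    refine hj'.resolve_right fun hR => ?_
    linarith [hconf.right j hR hcross, hp j]
  · intro hj
    obtain ⟨hcross, hexit⟩ := hconf.left j hj
    refine ⟨⟨List.mem_append_left _ hj, ?_, hcross, hexit.trans_lt ?_⟩, hexit⟩
    · rintro rfl
      exact List.disjoint_of_nodup_append hnd hj List.mem_cons_self
    · rw [endTime_append]
      exact lt_endTime hp _ (List.cons_ne_nil α R)

lemma Conforming.notMem_bannedTimes (hp : ∀ j, 0 ≤ p j) (hperm : (L ++ α :: R).Perm J)
    (hconf : Conforming w p t α L R) :
    endTime p t L ∉ bannedTimes (precompute w p).val α (banJobs w p t α J) t := by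
  refine notMem_bannedTimes_iff.2 ⟨le_endTime hp t L, fun j hj hle => ?_⟩
  rw [mem_banJobs, ← hperm.mem_iff, ← endTime_perm hperm] at hj
  obtain ⟨hmem, hne, hcross⟩ := hj
  have hj' : j ∈ L ∨ j ∈ R := by simpa [hne] using hmem
  rcases hj' with hL | hR
  · exact (hconf.left j hL).2
  · exact absurd hle (hconf.right j hR hcross).not_ge

lemma exists_mem_findStarts (hp : ∀ j, 0 < p j) (hnd : (a :: l).Nodup)
    (hperm : (L ++ pivot w p a l t :: R).Perm (a :: l))
    (hconf : Conforming w p t (pivot w p a l t) L R) :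
    ∃ br ∈ (findStarts w p (precompute w p).val a l t).val,
      br.left.Perm L ∧ br.right.Perm R := by
  set α := pivot w p a l t with hα
  set breaks := breakJobs w p t α (a :: l) with hbreaks
  set k₁ := breaks.filter fun j => tstar w p α j + p j ≤ endTime p t L with hk₁
  set k₂ := breaks.filter fun j => ¬ tstar w p α j + p j ≤ endTime p t L with hk₂
  have hsplit : breaks = k₁ ++ k₂ := eq_filter_append_filter
    (by simpa only [precompute_exit] using breakJobs_pairwise w p t α (a :: l)) (endTime p t L)
  have hleft : k₁.Perm L := hconf.filter_breakJobs_perm hp hnd hperm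
  have hmem : (⟨α, endTime p t L, k₁.reverse, k₂ ++ otherJobs w p t α (a :: l)⟩ : Branch n) ∈
      (findStarts w p (precompute w p).val a l t).val := by
    refine (mem_findStarts_iff hp).2 ⟨k₁, k₂, hsplit, ?_, le_endTime (fun j => (hp j).le) t L,
      ?_, ?_, ?_, hconf.notMem_bannedTimes (fun j => (hp j).le) hperm⟩
    · rw [← hbreaks, hsplit, endTime_perm hleft, ← hα]
      simp
    · simp [hk₁, ← hα]
    · simp [hk₂, ← hα]
    · rw [← endTime_perm hperm, endTime_append]
      exact lt_endTime hp _ (List.cons_ne_nil α R)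
  have hleft' := (List.reverse_perm k₁).trans hleft
  refine ⟨_, hmem, hleft', (List.perm_cons α).1 ((List.perm_append_left_iff L).1 ?_)⟩
  exact (hleft'.symm.append_right _).trans
    ((isBranch_of_mem_findStarts hp hnd hmem).perm.trans hperm.symm)

lemma findStarts_pairwise (hp : ∀ j, 0 < p j) (a : Fin n) (l : List (Fin n)) (t : ℝ) :
    (findStarts w p (precompute w p).val a l t).val.Pairwise fun b b' => b.start < b'.start := by
  rw [val_findStarts]
  exact scan_pairwise hp _

end FindStarts

/-! ### Some best schedule lies on a branch -/

section Conforming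

variable {n : ℕ} {w p : Fin n → ℝ} {i j : Fin n} {t te : ℝ}

lemma phi_le_phi_iff_linear (hp : ∀ j, 0 < p j) (ht : 0 ≤ t) :
    phi w p j t ≤ phi w p i t ↔
      w j * p i ^ 2 - w i * p j ^ 2 ≤ (w i * p j - w j * p i) * t := by
  rw [phi_le_phi_iff hp ht]
  constructor <;> intro h <;> linarith

lemma phi_le_phi_iff_le_tstar (hp : ∀ j, 0 < p j) (hij : w i * p j < w j * p i) (ht : 0 ≤ t) :
    phi w p j t ≤ phi w p i t ↔ t ≤ tstar w p i j := by
  rw [phi_le_phi_iff_linear hp ht, tstar, le_div_iff_of_neg (sub_neg.2 hij),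
    mul_comm t]

lemma phi_le_phi_iff_tstar_le (hp : ∀ j, 0 < p j) (hij : w i * p j < w j * p i) (ht : 0 ≤ t) :
    phi w p i t ≤ phi w p j t ↔ tstar w p i j ≤ t := by
  rw [phi_le_phi_iff_linear hp ht, tstar, div_le_iff_of_neg (sub_neg.2 hij)]
  constructor <;> intro h <;> linarith

lemma phi_le_of_phiKey_le (h : phiKey w p t te j ≤ phiKey w p t te i) :
    phi w p j t ≤ phi w p i t :=
  (phiKey_le_phiKey.1 h).elim le_of_lt fun h => h.1.le

lemma Crosses.mul_lt_mul (hp : ∀ j, 0 < p j) (ht : 0 ≤ t) (hc : Crosses w p t te i j)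
    (hkey : phiKey w p t te j ≤ phiKey w p t te i) : w i * p j < w j * p i := by
  have hlin := (phi_le_phi_iff_linear hp ht).1 (phi_le_of_phiKey_le hkey)
  have hlt := hc.1
  by_contra! hle
  rcases hle.eq_or_lt with heq | hpos
  · rw [tstar, heq, sub_self, div_zero] at hlt
    exact hlt.not_ge ht
  · rw [tstar, lt_div_iff₀ (sub_pos.2 hpos)] at hlt
    linarith

lemma phi_le_of_not_crosses (hp : ∀ j, 0 < p j) (ht : 0 ≤ t) (hc : ¬ Crosses w p t te i j)
    (hkey : phiKey w p t te j ≤ phiKey w p t te i) {s : ℝ} (hts : t ≤ s) (hste : s ≤ te) :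
    phi w p j s ≤ phi w p i s := by
  have hle := phi_le_of_phiKey_le hkey
  have hs := ht.trans hts
  rcases le_or_gt (w j * p i) (w i * p j) with hji | hij
  · rw [phi_le_phi_iff_linear hp ht] at hle
    rw [phi_le_phi_iff_linear hp hs]
    exact hle.trans (mul_le_mul_of_nonneg_left hts (sub_nonneg.2 hji))
  · by_contra hnot
    rw [phi_le_phi_iff_le_tstar hp hij hs, not_le] at hnot
    rcases ((phi_le_phi_iff_le_tstar hp hij ht).1 hle).eq_or_lt with heq | hlt
    · have hge := (phi_le_phi_iff_tstar_le hp hij ht).2 heq.ge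
      obtain ⟨-, hend⟩ := (phiKey_le_phiKey.1 hkey).resolve_left hge.not_gt
      rw [phi_le_phi_iff_le_tstar hp hij (hs.trans hste)] at hend
      linarith
    · exact hc ⟨hlt, hnot.trans_le hste⟩

variable {α : Fin n} {J L R : List (Fin n)}

lemma IsBest.exists_left_crosses (hw : ∀ j, 0 < w j) (hp : ∀ j, 0 < p j) (ht : 0 ≤ t)
    (hα : ∀ j ∈ J, phiKey w p t (endTime p t J) j ≤ phiKey w p t (endTime p t J) α)
    (h : IsBest w p J t (L ++ α :: R)) :
    ∃ L' R', IsBest w p J t (L' ++ α :: R') ∧ ∀ j ∈ L', Crosses w p t (endTime p t J) α j := by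
  induction hm : L.length using Nat.strong_induction_on generalizing L R with
  | _ m ih =>
    by_cases hall : ∀ j ∈ L, Crosses w p t (endTime p t J) α j
    · exact ⟨L, R, h, hall⟩
    push Not at hall
    obtain ⟨j, hj, hnot⟩ := hall
    obtain ⟨A, B, rfl⟩ := List.append_of_mem hj
    have hshort : A.length < m := by simp [← hm]
    by_cases hid : w α = w j ∧ p α = p j
    · have hswap := h.swap_identical hid.1 hid.2
      rw [List.append_assoc, List.cons_append] at hswap
      exact ih A.length hshort hswap rfl
    · have hle := fun (S : List (Fin n)) => le_endTime (fun j => (hp j).le) (p := p) (S := S)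
      have hend : endTime p t (A ++ B) ≤ endTime p t J := by
        rw [← endTime_perm h.1]
        simp only [endTime_append, endTime_cons, endTime_add]
        linarith [hp j, hp α, hle R (endTime p (endTime p t A) B)]
      have hφ {s : ℝ} := phi_le_of_not_crosses (s := s) hp ht hnot
        (hα j (h.1.mem_iff.1 (by simp)))
      have hstart : phi w p j (endTime p t A) ≤ phi w p α (endTime p t A) :=
        hφ (hle A t) ((hle B _).trans (by simpa using hend))
      obtain rfl := h.eq_nil_of_phi_le hw hp ht hstart (hφ (hle _ t) hend) hid
      rw [List.append_assoc] at h
      exact ih A.length hshort (h.swap_adjacent hp ht hstart) rfl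

lemma not_identical (hij : w i * p j < w j * p i) : ¬ (w i = w j ∧ p i = p j) := by
  rintro ⟨hw, hp⟩
  exact hij.ne (by rw [hw, hp])

lemma IsBest.tstar_add_le (hw : ∀ j, 0 < w j) (hp : ∀ j, 0 < p j) (ht : 0 ≤ t)
    (hαj : w α * p j < w j * p α) (h : IsBest w p J t (L ++ α :: R)) (hj : j ∈ L) :
    tstar w p α j + p j ≤ endTime p t L := by
  by_contra! hearly
  obtain ⟨A, B, rfl⟩ := List.append_of_mem hj
  have hle := fun (S : List (Fin n)) => le_endTime (fun j => (hp j).le) (p := p) (S := S)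
  simp only [endTime_append, endTime_cons] at hearly
  have hA : endTime p t A < tstar w p α j := by linarith [hle B (endTime p t A)]
  have hAB : endTime p t (A ++ B) < tstar w p α j := by
    rw [endTime_append]
    linarith
  have hstart := (phi_le_phi_iff_le_tstar hp hαj (ht.trans (hle A t))).2 hA.le
  have hend := (phi_le_phi_iff_le_tstar hp hαj (ht.trans (hle _ t))).2 hAB.le
  obtain rfl := h.eq_nil_of_phi_le hw hp ht hstart hend (not_identical hαj)
  rw [List.append_assoc] at h
  have hge := h.phi_le_of_adjacent hp ht
  rw [phi_le_phi_iff_tstar_le hp hαj (ht.trans (hle A t))] at hge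
  exact hA.not_ge hge

lemma IsBest.exists_conforming_of_left (hw : ∀ j, 0 < w j) (hp : ∀ j, 0 < p j) (ht : 0 ≤ t)
    (hα : ∀ j ∈ J, phiKey w p t (endTime p t J) j ≤ phiKey w p t (endTime p t J) α)
    (h : IsBest w p J t (L ++ α :: R)) (hL : ∀ j ∈ L, Crosses w p t (endTime p t J) α j) :
    ∃ L' R', IsBest w p J t (L' ++ α :: R') ∧ Conforming w p t α L' R' := by
  induction hm : R.length using Nat.strong_induction_on generalizing L R with
  | _ m ih =>
    by_cases hall : ∀ j ∈ R, Crosses w p t (endTime p t J) α j → endTime p t L < tstar w p α j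
    · refine ⟨L, R, h, ?_, ?_⟩ <;> rw [endTime_perm h.1]
      · refine fun j hj => ⟨hL j hj, h.tstar_add_le hw hp ht ?_ hj⟩
        exact (hL j hj).mul_lt_mul hp ht (hα j (h.1.mem_iff.1 (by simp [hj])))
      · exact hall
    push Not at hall
    obtain ⟨j, hj, hcross, hlate⟩ := hall
    have hαj := hcross.mul_lt_mul hp ht (hα j (h.1.mem_iff.1 (by simp [hj])))
    obtain ⟨B, Z, rfl⟩ := List.append_of_mem hj
    have hle := fun (S : List (Fin n)) => le_endTime (fun j => (hp j).le) (p := p) (S := S)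
    rw [← List.cons_append, ← List.append_assoc] at h
    have hstart := (phi_le_phi_iff_tstar_le hp hαj (ht.trans (hle L t))).2 hlate
    have hend := (phi_le_phi_iff_tstar_le hp hαj (ht.trans (hle (L ++ B) t))).2
      (hlate.trans (by simpa using hle B (endTime p t L)))
    obtain rfl := h.eq_nil_of_phi_le hw hp ht hstart hend
      fun hid => not_identical hαj ⟨hid.1.symm, hid.2.symm⟩
    have hswap : IsBest w p J t ((L ++ [j]) ++ α :: Z) := by
      rw [List.append_assoc] at h ⊢
      exact h.swap_adjacent hp ht hstart
    refine ih Z.length (by simp [← hm]) hswap (fun i hi => ?_) rfl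
    rcases List.mem_append.1 hi with hi | hi
    · exact hL i hi
    · exact List.mem_singleton.1 hi ▸ hcross

lemma exists_isBest_branch (hw : ∀ j, 0 < w j) (hp : ∀ j, 0 < p j) {a : Fin n} {l : List (Fin n)}
    (hnd : (a :: l).Nodup) (ht : 0 ≤ t) :
    ∃ br ∈ (findStarts w p (precompute w p).val a l t).val, ∃ L R : List (Fin n),
      L.Perm br.left ∧ R.Perm br.right ∧ IsBest w p (a :: l) t (L ++ br.job :: R) := by
  obtain ⟨S, hS⟩ := exists_isBest w p (a :: l) t
  have hα := fun (j : Fin n) => phiKey_le_pivot (w := w) (p := p) (a := a) (l := l) (j := j) t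
  obtain ⟨L, R, rfl⟩ := List.append_of_mem (hS.1.mem_iff.2 (pivot_mem w p a l t))
  obtain ⟨L, R, hS, hL⟩ := hS.exists_left_crosses hw hp ht hα
  obtain ⟨L, R, hS, hconf⟩ := hS.exists_conforming_of_left hw hp ht hα hL
  obtain ⟨br, hbr, hleft, hright⟩ := exists_mem_findStarts hp hnd hS.1 hconf
  refine ⟨br, hbr, L, R, hleft.symm, hright.symm, ?_⟩
  rwa [(isBranch_of_mem_findStarts hp hnd hbr).job_eq]

end Conforming

/-! ### Correctness of the recursion -/

section Correctness

variable {n : ℕ} {w p : Fin n → ℝ}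

/-- The recursive calls of `fastSchedule`: distinct jobs, a nonnegative start time, and a recursion
depth `d` that suffices. -/
structure IsCall (d : ℕ) (J : List (Fin n)) (t : ℝ) : Prop where
  length_le : J.length ≤ d
  nodup : J.Nodup
  nonneg : 0 ≤ t

lemma isCall_finRange (n : ℕ) : IsCall n (List.finRange n) 0 :=
  ⟨by simp, List.nodup_finRange n, le_rfl⟩

variable {d : ℕ} {a : Fin n} {l : List (Fin n)} {t : ℝ} {br : Branch n}

lemma IsBranch.nodup (hbr : IsBranch w p a l t br) (hnd : (a :: l).Nodup) :
    (br.left ++ br.job :: br.right).Nodup :=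
  hbr.perm.nodup_iff.2 hnd

lemma IsBranch.isCall_left (hbr : IsBranch w p a l t br) (h : IsCall (d + 1) (a :: l) t) :
    IsCall d br.left t := by
  refine ⟨?_, (hbr.nodup h.nodup).of_append_left, h.nonneg⟩
  have hlen := hbr.perm.length_eq
  have hle := h.length_le
  simp only [List.length_append, List.length_cons] at hlen hle
  omega

lemma IsBranch.isCall_right (hp : ∀ j, 0 ≤ p j) (hbr : IsBranch w p a l t br)
    (h : IsCall (d + 1) (a :: l) t) : IsCall d br.right (p br.job + br.start) := by
  refine ⟨?_, (List.nodup_cons.1 (hbr.nodup h.nodup).of_append_right).2, add_nonneg (hp _) ?_⟩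
  · have hlen := hbr.perm.length_eq
    have hle := h.length_le
    simp only [List.length_append, List.length_cons] at hlen hle
    omega
  · rw [hbr.start_eq]
    exact h.nonneg.trans (le_endTime hp t _)

theorem IsCall.induction (hp : ∀ j, 0 < p j) {motive : ℕ → List (Fin n) → ℝ → Prop}
    (nil : ∀ d t, motive d [] t) (singleton : ∀ d j t, motive (d + 1) [j] t)
    (branch : ∀ d a b l t, IsCall (d + 1) (a :: b :: l) t →
      (∀ br ∈ (findStarts w p (precompute w p).val a (b :: l) t).val,
        motive d br.left t ∧ motive d br.right (p br.job + br.start)) →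
      motive (d + 1) (a :: b :: l) t)
    {J : List (Fin n)} (h : IsCall d J t) : motive d J t := by
  induction d generalizing J t with
  | zero =>
    obtain rfl := List.length_eq_zero_iff.1 (Nat.le_zero.1 h.length_le)
    exact nil 0 t
  | succ d ih =>
    match J with
    | [] => exact nil _ t
    | [j] => exact singleton d j t
    | a :: b :: l =>
      refine branch d a b l t h fun br hbr => ?_
      have hbr' := isBranch_of_mem_findStarts hp h.nodup hbr
      exact ⟨ih (hbr'.isCall_left h), ih (hbr'.isCall_right (fun j => (hp j).le) h)⟩

/-- The value and the sequence that `fastSchedule` obtains from a branch of a call of depth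
`d + 1`. -/
def branchResult (w p : Fin n → ℝ) (d : ℕ) (t : ℝ) (br : Branch n) : ℝ × List (Fin n) :=
  let optL := (fastSchedule w p (precompute w p).val d br.left t).val
  let optR := (fastSchedule w p (precompute w p).val d br.right (p br.job + br.start)).val
  (optL.1 + optR.1 + w br.job / (p br.job + br.start), optL.2 ++ br.job :: optR.2)

lemma val_foldlM {β γ : Type} (f : β → γ → Timed β) (b : β) (l : List γ) :
    (l.foldlM f b).val = l.foldl (fun b c => (f b c).val) b := by
  induction l generalizing b with
  | nil => rfl
  | cons c _ ih => exact ih _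

lemma val_fastSchedule (w p : Fin n → ℝ) (d : ℕ) (a b : Fin n) (l : List (Fin n)) (t : ℝ) :
    (fastSchedule w p (precompute w p).val (d + 1) (a :: b :: l) t).val =
      ((findStarts w p (precompute w p).val a (b :: l) t).val.map (branchResult w p d t)).foldl
        (fun best r => if best.1 < r.1 then r else best) (0, []) := by
  rw [fastSchedule, val_bind, val_bind, val_foldlM, List.foldl_map]
  congr 1
  funext best br
  simp only [val_bind, val_ite, val_read, val_addR, val_divR, val_ltR, val_pure, val_append,
    decide_eq_true_eq, branchResult]
  rfl

lemma foldl_ite_lt_spec {β γ : Type*} [LinearOrder γ] (key : β → γ) (b : β) (l : List β) :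
    l.foldl (fun x y => if key x < key y then y else x) b ∈ b :: l ∧
      ∀ x ∈ b :: l, key x ≤ key (l.foldl (fun x y => if key x < key y then y else x) b) := by
  induction l generalizing b with
  | nil => simp
  | cons c l ih =>
    obtain ⟨hmem, hle⟩ := ih (if key b < key c then c else b)
    simp only [List.mem_cons, forall_eq_or_imp] at hmem hle ⊢
    rw [List.foldl_cons]
    split_ifs at hmem hle ⊢ with h
    · exact ⟨Or.inr hmem, h.le.trans hle.1, hle⟩
    · exact ⟨hmem.imp_right Or.inr, hle.1, (not_lt.1 h).trans hle.1, hle.2⟩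

/-- `r` consists of the maximum value of the jobs of `J` processed from time `t` on and of a
sequence that attains it. -/
def IsSolution (w p : Fin n → ℝ) (J : List (Fin n)) (t : ℝ) (r : ℝ × List (Fin n)) : Prop :=
  IsBest w p J t r.2 ∧ r.1 = value w p t r.2

lemma IsBranch.value_append_cons (hbr : IsBranch w p a l t br) {L : List (Fin n)}
    (hL : L.Perm br.left) (R : List (Fin n)) :
    value w p t (L ++ br.job :: R) =
      value w p t L + value w p (p br.job + br.start) R + w br.job / (p br.job + br.start) := by
  rw [value_append, value, endTime_perm hL, ← hbr.start_eq]
  ring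

lemma isSolution_fastSchedule (hw : ∀ j, 0 < w j) (hp : ∀ j, 0 < p j) {J : List (Fin n)}
    (h : IsCall d J t) :
    IsSolution w p J t (fastSchedule w p (precompute w p).val d J t).val := by
  refine IsCall.induction (w := w) (motive := fun d J t =>
    IsSolution w p J t (fastSchedule w p (precompute w p).val d J t).val) hp ?_ ?_ ?_ h
  · intro d t
    cases d <;> simp [fastSchedule, IsSolution, IsBest, value]
  · intro d j t
    simp [fastSchedule, IsSolution, IsBest, value]
  intro d a b l t h ih
  have hresult : ∀ br ∈ (findStarts w p (precompute w p).val a (b :: l) t).val,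
      (branchResult w p d t br).2.Perm (a :: b :: l) ∧
        (branchResult w p d t br).1 = value w p t (branchResult w p d t br).2 := by
    intro br hbr
    have hbr' := isBranch_of_mem_findStarts hp h.nodup hbr
    obtain ⟨⟨hpermL, -⟩, hvalL⟩ := (ih br hbr).1
    obtain ⟨⟨hpermR, -⟩, hvalR⟩ := (ih br hbr).2
    refine ⟨(hpermL.append (hpermR.cons _)).trans hbr'.perm, ?_⟩
    simp only [branchResult]
    rw [hbr'.value_append_cons hpermL, hvalL, hvalR]
  obtain ⟨br, hbr, L, R, hL, hR, hbest⟩ := exists_isBest_branch hw hp h.nodup h.nonneg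
  have hbranch : value w p t (L ++ br.job :: R) ≤ (branchResult w p d t br).1 := by
    rw [(isBranch_of_mem_findStarts hp h.nodup hbr).value_append_cons hL]
    obtain ⟨⟨-, hmaxL⟩, hvalL⟩ := (ih br hbr).1
    obtain ⟨⟨-, hmaxR⟩, hvalR⟩ := (ih br hbr).2
    simp only [branchResult, hvalL, hvalR]
    linarith [hmaxL L hL, hmaxR R hR]
  have hpos : 0 < value w p t (L ++ br.job :: R) := by
    refine lt_of_lt_of_le ?_ (hbest.2 (a :: b :: l) (List.Perm.refl _))
    have hat : 0 < p a + t := add_pos_of_pos_of_nonneg (hp a) h.nonneg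
    exact add_pos_of_pos_of_nonneg (div_pos (hw a) hat)
      (value_nonneg (fun j => (hw j).le) (fun j => (hp j).le) hat.le (b :: l))
  obtain ⟨hmem, hmax⟩ := foldl_ite_lt_spec Prod.fst ((0 : ℝ), ([] : List (Fin n)))
    ((findStarts w p (precompute w p).val a (b :: l) t).val.map (branchResult w p d t))
  rw [← val_fastSchedule] at hmem hmax
  set r := (fastSchedule w p (precompute w p).val (d + 1) (a :: b :: l) t).val
  have hge := hbranch.trans (hmax _ (List.mem_cons_of_mem _ (List.mem_map_of_mem hbr)))
  have hne : r ≠ (0, []) := fun hr => (hpos.trans_le hge).ne' (by rw [hr])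
  obtain ⟨c, hc, hcr⟩ := List.mem_map.1 ((List.mem_cons.1 hmem).resolve_left hne)
  obtain ⟨hperm, hval⟩ := hcr ▸ hresult c hc
  exact ⟨⟨hperm, fun S hS => (hbest.2 S hS).trans (hge.trans_eq hval)⟩, hval⟩

lemma startTime_cons_self (t : ℝ) (j : Fin n) (S : List (Fin n)) :
    startTime p t (j :: S) j = t := by
  simp [startTime]

lemma startTime_cons_of_ne (t : ℝ) {i j : Fin n} (h : i ≠ j) (S : List (Fin n)) :
    startTime p t (j :: S) i = startTime p (p j + t) S i := by
  simp only [startTime, List.idxOf_cons_ne S h.symm, List.take_succ_cons, List.map_cons,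
    List.sum_cons]
  ring

lemma cost_eq_neg_value {S : List (Fin n)} (hS : S.Nodup) (t : ℝ) :
    cost w p t S = -value w p t S := by
  induction S generalizing t with
  | nil => simp [cost, value]
  | cons j S ih =>
    obtain ⟨hj, hS⟩ := List.nodup_cons.1 hS
    rw [value, neg_add, ← ih hS]
    simp only [cost, List.map_cons, List.sum_cons, completionTime, startTime_cons_self]
    congr 2
    · rw [add_comm, neg_div]
    · refine List.map_congr_left fun i hi => ?_
      rw [startTime_cons_of_ne t (ne_of_mem_of_not_mem hi hj)]

theorem solve_isOptimal (hw : ∀ j, 0 < w j) (hp : ∀ j, 0 < p j) :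
    IsOptimal w p (solve w p).val.2 ∧ (solve w p).val.1 = -cost w p 0 (solve w p).val.2 := by
  have hcost {S : List (Fin n)} (hS : IsSchedule S) : cost w p 0 S = -value w p 0 S :=
    cost_eq_neg_value (hS.nodup_iff.2 (List.nodup_finRange n)) 0
  obtain ⟨⟨hperm, hmax⟩, hval⟩ : IsSolution w p (List.finRange n) 0 (solve w p).val :=
    isSolution_fastSchedule hw hp (isCall_finRange n)
  refine ⟨⟨hperm, fun S hS => ?_⟩, ?_⟩
  · rw [hcost hperm, hcost hS]
    exact neg_le_neg (hmax S hS)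
  · rw [hcost hperm, neg_neg, hval]

end Correctness

/-! ### Branches contain potential schedules -/

section Potential

open Filter Topology

variable {n : ℕ} {w p : Fin n → ℝ} {i j : Fin n} {t : ℝ} {S : List (Fin n)}

/-- A sufficient condition for being a potential schedule, convenient for recursion: whenever `x`
precedes `y`, there is a moment between the start of `x` and `p_x` before the start of `y` just
after which `φ_x ≥ φ_y`. -/
def Consistent (w p : Fin n → ℝ) (t : ℝ) (S : List (Fin n)) : Prop :=
  ∀ A x B y Z, S = A ++ x :: B ++ y :: Z →
    ∃ τ ∈ Set.Icc (endTime p t A) (endTime p t (A ++ B)),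
      ∀ᶠ s in 𝓝[>] τ, phi w p y s ≤ phi w p x s

lemma consistent_nil (w p : Fin n → ℝ) (t : ℝ) : Consistent w p t [] := by
  intro A x B y Z h
  simp at h

lemma consistent_singleton (w p : Fin n → ℝ) (t : ℝ) (j : Fin n) : Consistent w p t [j] := by
  intro A x B y Z h
  have hlen := congrArg List.length h
  simp only [List.length_append, List.length_cons, List.length_nil] at hlen
  omega

lemma Consistent.append (hp : ∀ j, 0 ≤ p j) {L R : List (Fin n)} (hL : Consistent w p t L)
    (hR : Consistent w p (endTime p t L) R)
    (hLR : ∀ A x B, L = A ++ x :: B → ∀ y ∈ R,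
      ∀ᶠ s in 𝓝[>] endTime p t (A ++ B), phi w p y s ≤ phi w p x s) :
    Consistent w p t (L ++ R) := by
  intro A x B y Z h
  have hcross {B' C : List (Fin n)} (hB : B = B' ++ C) (hL' : L = A ++ x :: B') (hy : y ∈ R) :
      ∃ τ ∈ Set.Icc (endTime p t A) (endTime p t (A ++ B)),
        ∀ᶠ s in 𝓝[>] τ, phi w p y s ≤ phi w p x s := by
    refine ⟨_, ⟨?_, ?_⟩, hLR A x B' hL' y hy⟩
    · rw [endTime_append]
      exact le_endTime hp _ B'
    · rw [hB, ← List.append_assoc, endTime_append (S := A ++ B')]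
      exact le_endTime hp _ C
  rcases List.append_eq_append_iff.1 h with ⟨C, hC, rfl⟩ | ⟨C, rfl, hC⟩
  · rcases List.append_eq_append_iff.1 hC with ⟨D, rfl, hD⟩ | ⟨D, rfl, rfl⟩
    · rcases List.cons_eq_append_iff.1 hD with ⟨rfl, rfl⟩ | ⟨B', rfl, hB⟩
      · simpa using hR [] x B y Z rfl
      · exact hcross hB rfl (by simp)
    · simpa only [List.append_assoc, endTime_append] using hR D x B y Z rfl
  · rcases List.cons_eq_append_iff.1 hC with ⟨rfl, rfl⟩ | ⟨Z', rfl, -⟩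
    · exact hcross (List.append_nil B).symm (by simp) (by simp)
    · exact hL A x B y Z' rfl

lemma Conforming.consistent (hp : ∀ j, 0 < p j) (ht : 0 ≤ t) {α : Fin n} {L R : List (Fin n)}
    (h : Conforming w p t α L R)
    (hα : ∀ j ∈ L ++ α :: R, phiKey w p t (endTime p t (L ++ α :: R)) j ≤
      phiKey w p t (endTime p t (L ++ α :: R)) α)
    (hL : Consistent w p t L) (hR : Consistent w p (p α + endTime p t L) R) :
    Consistent w p t (L ++ α :: R) := by
  have hp' := fun j => (hp j).le
  have hle := fun (S : List (Fin n)) (t : ℝ) => le_endTime hp' t S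
  have hbefore {x : Fin n} (hx : x ∈ L) {τ : ℝ} (hτ : endTime p t L = p x + τ) :
      ∀ᶠ s in 𝓝[>] τ, phi w p α s ≤ phi w p x s := by
    obtain ⟨hc, hend⟩ := h.left x hx
    filter_upwards [self_mem_nhdsWithin] with s hs
    have hs' : tstar w p α x ≤ s := by linarith [Set.mem_Ioi.1 hs]
    exact (phi_le_phi_iff_tstar_le hp (hc.mul_lt_mul hp ht (hα x (by simp [hx])))
      (ht.trans (hc.1.le.trans hs'))).2 hs'
  have hafter {y : Fin n} (hy : y ∈ R) {τ : ℝ} (htτ : t ≤ τ) (hτ : τ ≤ endTime p t L) :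
      ∀ᶠ s in 𝓝[>] τ, phi w p y s ≤ phi w p α s := by
    have hkey := hα y (by simp [hy])
    have hτ' : τ < endTime p t (L ++ α :: R) :=
      hτ.trans_lt (endTime_append t L (α :: R) ▸ lt_endTime hp _ (List.cons_ne_nil α R))
    by_cases hc : Crosses w p t (endTime p t (L ++ α :: R)) α y
    · filter_upwards [self_mem_nhdsWithin,
        nhdsWithin_le_nhds (Iio_mem_nhds (hτ.trans_lt (h.right y hy hc)))] with s hs hs'
      exact (phi_le_phi_iff_le_tstar hp (hc.mul_lt_mul hp ht hkey)
        (ht.trans (htτ.trans (Set.mem_Ioi.1 hs).le))).2 (Set.mem_Iio.1 hs').le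
    · filter_upwards [self_mem_nhdsWithin, nhdsWithin_le_nhds (Iio_mem_nhds hτ')] with s hs hs'
      exact phi_le_of_not_crosses hp ht hc hkey (htτ.trans (Set.mem_Ioi.1 hs).le)
        (Set.mem_Iio.1 hs').le
  have hαR : Consistent w p (endTime p t L) ([α] ++ R) := by
    refine (consistent_singleton w p _ α).append hp' (by simpa using hR) fun A x B hAB y hy => ?_
    obtain ⟨rfl, ⟨rfl, rfl⟩⟩ : A = [] ∧ α = x ∧ [] = B := by
      cases A <;> simp_all
    simpa using hafter hy (hle L t) le_rfl
  refine hL.append hp' hαR fun A x B hAB y hy => ?_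
  subst hAB
  have hx := hbefore (x := x) (by simp) (τ := endTime p t (A ++ B)) (by simp)
  rcases List.mem_cons.1 hy with rfl | hy
  · exact hx
  · have hend : endTime p t (A ++ B) ≤ endTime p t (A ++ x :: B) := by
      simp [hp' x]
    filter_upwards [hx, hafter hy (hle _ t) hend] with s hxs hys
    exact hys.trans hxs

lemma phi_lt_of_forall_le (hw : ∀ j, 0 < w j) (hp : ∀ j, 0 < p j) (hne : w i ≠ w j)
    (h : ∀ t, 0 ≤ t → phi w p j t ≤ phi w p i t) {s : ℝ} (hs : 0 < s) :
    phi w p j s < phi w p i s := by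
  by_contra! hge
  rw [phi_le_phi_iff_linear hp hs.le] at hge
  have hzero := (phi_le_phi_iff_linear hp le_rfl).1 (h 0 le_rfl)
  have htwo := (phi_le_phi_iff_linear hp (by positivity)).1 (h (2 * s) (by positivity))
  have hslope : (w i * p j - w j * p i) * s = 0 := by linarith
  have hmul : w i * p j = w j * p i :=
    sub_eq_zero.1 ((mul_eq_zero.1 hslope).resolve_right hs.ne')
  have hconst : w j * p i ^ 2 - w i * p j ^ 2 = 0 := by linarith
  have hdiff : w j * p i * (p i - p j) = 0 := by linear_combination hconst + p j * hmul
  have hpij : p i = p j :=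
    sub_eq_zero.1 ((mul_eq_zero.1 hdiff).resolve_left (mul_pos (hw j) (hp i)).ne')
  exact hne (mul_right_cancel₀ (hp j).ne' (hmul.trans (by rw [hpij])))

lemma phi_le_phi_of_mul_le_mul (hw : ∀ j, 0 < w j) (hp : ∀ j, 0 < p j) (hij : w i < w j)
    (hmul : w j * p i ≤ w i * p j) (ht : 0 ≤ t) : phi w p j t ≤ phi w p i t := by
  have hpij : p i < p j :=
    lt_of_mul_lt_mul_left (hmul.trans_lt (mul_lt_mul_of_pos_right hij (hp j))) (hw j).le
  have hsq : w j * p i ^ 2 ≤ w i * p j ^ 2 := calc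
    w j * p i ^ 2 = w j * p i * p i := by ring
    _ ≤ w i * p j * p j := mul_le_mul hmul hpij.le (hp i).le (mul_pos (hw i) (hp j)).le
    _ = w i * p j ^ 2 := by ring
  rw [phi_le_phi_iff_linear hp ht]
  exact (sub_nonpos.2 hsq).trans (mul_nonneg (sub_nonneg.2 hmul) ht)

lemma Rule.eventually_lt (hw : ∀ j, 0 < w j) (hp : ∀ j, 0 < p j) {I : Set ℝ}
    (h : Rule w p i j I) {τ : ℝ} (hτ : τ ∈ I) (hτ0 : 0 ≤ τ) :
    ∀ᶠ s in 𝓝[>] τ, phi w p j s < phi w p i s := by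
  have hmul {i j : Fin n} (hij : w i < w j) (h : ¬ ∀ t, 0 ≤ t → phi w p j t ≤ phi w p i t) :
      w i * p j < w j * p i :=
    lt_of_not_ge fun hmul => h fun _ => phi_le_phi_of_mul_le_mul hw hp hij hmul
  cases h with
  | first _ _ hij h =>
    filter_upwards [self_mem_nhdsWithin] with s hs
    exact phi_lt_of_forall_le hw hp hij.ne h (hτ0.trans_lt hs)
  | second _ _ hij h =>
    filter_upwards [self_mem_nhdsWithin] with s hs
    exact phi_lt_of_forall_le hw hp hij.ne' h (hτ0.trans_lt hs)
  | early _ _ hij h₁ _ =>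
    filter_upwards [self_mem_nhdsWithin, nhdsWithin_le_nhds (Iio_mem_nhds hτ.2)] with s hs hs'
    rw [← not_le, phi_le_phi_iff_tstar_le hp (hmul hij h₁) (hτ0.trans (Set.mem_Ioi.1 hs).le)]
    exact not_le.2 hs'
  | late _ _ hij h₁ _ =>
    filter_upwards [self_mem_nhdsWithin] with s hs
    rw [← not_le, phi_le_phi_iff_le_tstar hp (hmul hij h₁) (hτ0.trans (Set.mem_Ioi.1 hs).le)]
    exact not_le.2 (lt_of_le_of_lt hτ hs)

lemma Rule.ordConnected {I : Set ℝ} (h : Rule w p i j I) : I.OrdConnected := by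
  cases h <;> infer_instance

lemma startTime_append_cons_self (t : ℝ) {A : List (Fin n)} (hj : j ∉ A) (B : List (Fin n)) :
    startTime p t (A ++ j :: B) j = endTime p t A := by
  induction A generalizing t with
  | nil => simpa using startTime_cons_self t j B
  | cons a A ih =>
    obtain ⟨hja, hjA⟩ := List.ne_and_not_mem_of_not_mem_cons hj
    rw [List.cons_append, startTime_cons_of_ne t hja, ih _ hjA, endTime_cons, endTime_add]

lemma exists_eq_append_of_startTime_lt (hp : ∀ j, 0 ≤ p j) (hi : i ∈ S) (hj : j ∈ S)
    (h : startTime p t S j < startTime p t S i) :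
    ∃ A B Z, S = A ++ j :: B ++ i :: Z ∧ startTime p t S j = endTime p t A ∧
      startTime p t S i = p j + endTime p t (A ++ B) := by
  obtain ⟨A, B, rfl, hjA⟩ := List.eq_append_cons_of_mem hj
  have hstart := startTime_append_cons_self (p := p) t hjA B
  by_cases hiA : i ∈ A
  · obtain ⟨A₁, A₂, rfl, hiA₁⟩ := List.eq_append_cons_of_mem hiA
    rw [hstart, List.append_assoc, List.cons_append, startTime_append_cons_self t hiA₁,
      endTime_append] at h
    exact absurd h (le_endTime hp _ _).not_gt
  have hij : i ≠ j := by
    rintro rfl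
    exact lt_irrefl _ h
  obtain ⟨B, Z, rfl, hiB⟩ := List.eq_append_cons_of_mem
    (((List.mem_append.1 hi).resolve_left hiA |> List.mem_cons.1).resolve_left hij)
  refine ⟨A, B, Z, by simp, hstart, ?_⟩
  rw [← List.cons_append, ← List.append_assoc, startTime_append_cons_self t (by simp [*])]
  simp

lemma Consistent.isPotential (hw : ∀ j, 0 < w j) (hp : ∀ j, 0 < p j) (ht : 0 ≤ t)
    (h : Consistent w p t S) : IsPotential w p t S := by
  rintro i j I hI ⟨hi, hj, hle, hjI, hiI⟩
  obtain ⟨A, B, Z, rfl, hjA, hiB⟩ := exists_eq_append_of_startTime_lt (fun j => (hp j).le) hi hj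
    (by linarith [hp j])
  obtain ⟨τ, hτ, hge⟩ := h A j B i Z rfl
  rw [hiB, add_sub_cancel_left] at hiI
  have hlt := hI.eventually_lt hw hp (hI.ordConnected.out (hjA ▸ hjI) hiI hτ)
    (ht.trans ((le_endTime (fun j => (hp j).le) t A).trans hτ.1))
  obtain ⟨s, hge, hlt⟩ := (hge.and hlt).exists
  exact hge.not_gt hlt

end Potential

section Leaves

variable {n : ℕ} {w p : Fin n → ℝ} {d : ℕ} {a b : Fin n} {l J S : List (Fin n)} {t : ℝ}

/-- The sequences that arise in the recursion of depth `d` on the job set `J` at time `t` from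
choosing one branch in every recursive call. -/
def leaves (w p : Fin n → ℝ) : ℕ → List (Fin n) → ℝ → List (List (Fin n))
  | _, [], _ => [[]]
  | 0, _ :: _, _ => []
  | _ + 1, [j], _ => [[j]]
  | d + 1, a :: b :: l, t =>
    (findStarts w p (precompute w p).val a (b :: l) t).val.flatMap fun br =>
      (leaves w p d br.left t).flatMap fun L =>
        (leaves w p d br.right (p br.job + br.start)).map fun R => L ++ br.job :: R

lemma leaves_nil (w p : Fin n → ℝ) (d : ℕ) (t : ℝ) : leaves w p d [] t = [[]] := by
  cases d <;> rfl

lemma mem_leaves_cons_cons :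
    S ∈ leaves w p (d + 1) (a :: b :: l) t ↔
      ∃ br ∈ (findStarts w p (precompute w p).val a (b :: l) t).val,
        ∃ L ∈ leaves w p d br.left t, ∃ R ∈ leaves w p d br.right (p br.job + br.start),
          L ++ br.job :: R = S := by
  simp [leaves]

lemma perm_of_mem_leaves (hp : ∀ j, 0 < p j) (h : IsCall d J t) (hS : S ∈ leaves w p d J t) :
    S.Perm J := by
  revert S
  refine IsCall.induction (w := w) (motive := fun d J t => ∀ {S}, S ∈ leaves w p d J t → S.Perm J)
    hp (by simp [leaves_nil]) (by simp [leaves]) ?_ h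
  intro d a b l t h ih S hS
  obtain ⟨br, hbr, L, hL, R, hR, rfl⟩ := mem_leaves_cons_cons.1 hS
  exact (((ih br hbr).1 hL).append (((ih br hbr).2 hR).cons _)).trans
    (isBranch_of_mem_findStarts hp h.nodup hbr).perm

lemma consistent_of_mem_leaves (hp : ∀ j, 0 < p j) (h : IsCall d J t)
    (hS : S ∈ leaves w p d J t) : Consistent w p t S := by
  revert S
  refine IsCall.induction (w := w)
    (motive := fun d J t => ∀ {S}, S ∈ leaves w p d J t → Consistent w p t S)
    hp (by simp [leaves_nil, consistent_nil]) (by simp [leaves, consistent_singleton]) ?_ h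
  intro d a b l t h ih S hS
  obtain ⟨br, hbr, L, hL, R, hR, rfl⟩ := mem_leaves_cons_cons.1 hS
  have hbr' := isBranch_of_mem_findStarts hp h.nodup hbr
  have hpermL := perm_of_mem_leaves hp (hbr'.isCall_left h) hL
  have hpermR := perm_of_mem_leaves hp (hbr'.isCall_right (fun j => (hp j).le) h) hR
  have hperm := (hpermL.append (hpermR.cons br.job)).trans hbr'.perm
  refine (hbr'.conforming.of_perm hpermL.symm hpermR.symm).consistent hp h.nonneg (fun j hj => ?_)
    ((ih br hbr).1 hL) ?_
  · rw [endTime_perm hperm, hbr'.job_eq]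
    exact phiKey_le_pivot t (hperm.mem_iff.1 hj)
  · rw [endTime_perm hpermL, ← hbr'.start_eq]
    exact (ih br hbr).2 hR

lemma leaves_ne_nil (hw : ∀ j, 0 < w j) (hp : ∀ j, 0 < p j) (h : IsCall d J t) :
    leaves w p d J t ≠ [] := by
  refine IsCall.induction (w := w) (motive := fun d J t => leaves w p d J t ≠ [])
    hp (by simp [leaves_nil]) (by simp [leaves]) ?_ h
  intro d a b l t h ih
  obtain ⟨br, hbr, -⟩ := exists_isBest_branch hw hp h.nodup h.nonneg
  obtain ⟨L, hL⟩ := List.exists_mem_of_ne_nil _ (ih br hbr).1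
  obtain ⟨R, hR⟩ := List.exists_mem_of_ne_nil _ (ih br hbr).2
  exact List.ne_nil_of_mem (mem_leaves_cons_cons.2 ⟨br, hbr, L, hL, R, hR, rfl⟩)

lemma IsBranch.startTime_job {br : Branch n} (hbr : IsBranch w p a l t br) (hnd : (a :: l).Nodup)
    {L : List (Fin n)} (hL : L.Perm br.left) (R : List (Fin n)) :
    startTime p t (L ++ br.job :: R) br.job = br.start := by
  have hjob : br.job ∉ br.left := fun h =>
    List.disjoint_of_nodup_append (hbr.nodup hnd) h List.mem_cons_self
  rw [startTime_append_cons_self t (hL.mem_iff.not.2 hjob), endTime_perm hL, hbr.start_eq]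

lemma leaves_nodup (hp : ∀ j, 0 < p j) (h : IsCall d J t) : (leaves w p d J t).Nodup := by
  refine IsCall.induction (w := w) (motive := fun d J t => (leaves w p d J t).Nodup)
    hp (by simp [leaves_nil]) (by simp [leaves]) ?_ h
  intro d a b l t h ih
  have hbranch {br : Branch n}
      (hbr : br ∈ (findStarts w p (precompute w p).val a (b :: l) t).val) :=
    isBranch_of_mem_findStarts hp h.nodup hbr
  have hleft {br : Branch n} {L : List (Fin n)}
      (hbr : br ∈ (findStarts w p (precompute w p).val a (b :: l) t).val)
      (hL : L ∈ leaves w p d br.left t) : L.Perm br.left :=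
    perm_of_mem_leaves hp ((hbranch hbr).isCall_left h) hL
  rw [leaves, List.nodup_flatMap]
  constructor
  · intro br hbr
    rw [List.nodup_flatMap]
    refine ⟨fun L _ => (ih br hbr).2.map fun R R' hRR' => by simpa using hRR', ?_⟩
    refine (ih br hbr).1.imp_of_mem fun hL hL' hne S hS hS' => hne ?_
    obtain ⟨R, -, rfl⟩ := List.mem_map.1 hS
    obtain ⟨R', -, heq⟩ := List.mem_map.1 hS'
    exact (List.append_inj heq ((hleft hbr hL').trans (hleft hbr hL).symm).length_eq).1.symm
  -- Different branches place the pivot at different times.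
  · refine (findStarts_pairwise hp a (b :: l) t).imp_of_mem fun hbr hbr' hlt S hS hS' => ?_
    simp only [List.mem_flatMap, List.mem_map] at hS hS'
    obtain ⟨L, hL, R, -, rfl⟩ := hS
    obtain ⟨L', hL', R', -, heq⟩ := hS'
    refine hlt.ne ?_
    rw [← (hbranch hbr).startTime_job h.nodup (hleft hbr hL) R,
      ← (hbranch hbr').startTime_job h.nodup (hleft hbr' hL') R', heq, (hbranch hbr).job_eq,
      (hbranch hbr').job_eq]

lemma isSchedule_of_mem_leaves (hp : ∀ j, 0 < p j)
    (hS : S ∈ leaves w p n (List.finRange n) 0) : IsSchedule S :=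
  perm_of_mem_leaves hp (isCall_finRange n) hS

lemma isPotential_of_mem_leaves (hw : ∀ j, 0 < w j) (hp : ∀ j, 0 < p j)
    (hS : S ∈ leaves w p n (List.finRange n) 0) : IsPotential w p 0 S :=
  (consistent_of_mem_leaves hp (isCall_finRange n) hS).isPotential hw hp le_rfl

lemma finite_isSchedule (n : ℕ) : {S : List (Fin n) | IsSchedule S}.Finite :=
  (List.finite_toSet (List.finRange n).permutations).subset fun _ => List.mem_permutations.2

theorem length_leaves_le_numPotential (hw : ∀ j, 0 < w j) (hp : ∀ j, 0 < p j) :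
    (leaves w p n (List.finRange n) 0).length ≤ numPotential w p := by
  rw [← List.toFinset_card_of_nodup (leaves_nodup hp (isCall_finRange n)), ← Set.ncard_coe_finset]
  refine Set.ncard_le_ncard (fun S hS => ?_) ((finite_isSchedule n).subset fun S hS => hS.1)
  have hS := List.mem_toFinset.1 (Finset.mem_coe.1 hS)
  exact ⟨isSchedule_of_mem_leaves hp hS, isPotential_of_mem_leaves hw hp hS⟩

/-- The explored call on `(J, t)`, for which `Q` is the set of the schedules that agree with all
branches taken before, is the recursive call of depth `d` on the jobs between `A` and `Z`: each of
its leaves `S` extends to the leaf `A ++ S ++ Z` of the whole recursion. -/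
structure IsContext (w p : Fin n → ℝ) (d : ℕ) (J : List (Fin n)) (t : ℝ)
    (Q : Set (List (Fin n))) (A Z : List (Fin n)) : Prop where
  isCall : IsCall d J t
  start_eq : t = endTime p 0 A
  mem : ∀ S ∈ leaves w p d J t, A ++ S ++ Z ∈ Q
  mem_leaves : ∀ S ∈ leaves w p d J t, A ++ S ++ Z ∈ leaves w p n (List.finRange n) 0

variable {Q : Set (List (Fin n))} {A Z : List (Fin n)} {br : Branch n}

lemma IsContext.mem_inter_schedules (hp : ∀ j, 0 < p j)
    (h : IsContext w p (d + 1) (a :: b :: l) t Q A Z)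
    (hbr : br ∈ (findStarts w p (precompute w p).val a (b :: l) t).val) {L R : List (Fin n)}
    (hL : L ∈ leaves w p d br.left t)
    (hR : R ∈ leaves w p d br.right (p br.job + br.start)) :
    A ++ (L ++ br.job :: R) ++ Z ∈ Q ∩ br.schedules p ∧
      A ++ (L ++ br.job :: R) ++ Z ∈ leaves w p n (List.finRange n) 0 := by
  have hbr' := isBranch_of_mem_findStarts hp h.isCall.nodup hbr
  have hpermL := perm_of_mem_leaves hp (hbr'.isCall_left h.isCall) hL
  have hpermR := perm_of_mem_leaves hp (hbr'.isCall_right (fun j => (hp j).le) h.isCall) hR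
  have hS := mem_leaves_cons_cons.2 ⟨br, hbr, L, hL, R, hR, rfl⟩
  have hleaf := h.mem_leaves _ hS
  refine ⟨⟨h.mem _ hS, ?_, A, L, R, Z, hpermL, hpermR, by simp⟩, hleaf⟩
  have hnd := (isSchedule_of_mem_leaves hp hleaf).nodup_iff.2 (List.nodup_finRange n)
  have hsplit : A ++ (L ++ br.job :: R) ++ Z = (A ++ L) ++ br.job :: (R ++ Z) := by simp
  rw [hsplit] at hnd ⊢
  rw [startTime_append_cons_self 0 fun hjob => List.disjoint_of_nodup_append hnd hjob (by simp),
    endTime_append, ← h.start_eq, endTime_perm hpermL, hbr'.start_eq]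

lemma IsContext.exists_left (hw : ∀ j, 0 < w j) (hp : ∀ j, 0 < p j)
    (h : IsContext w p (d + 1) (a :: b :: l) t Q A Z)
    (hbr : br ∈ (findStarts w p (precompute w p).val a (b :: l) t).val) :
    ∃ Z', IsContext w p d br.left t (Q ∩ br.schedules p) A Z' := by
  have hbr' := isBranch_of_mem_findStarts hp h.isCall.nodup hbr
  obtain ⟨R, hR⟩ := List.exists_mem_of_ne_nil _
    (leaves_ne_nil hw hp (hbr'.isCall_right (fun j => (hp j).le) h.isCall))
  have hmem (L : List (Fin n)) (hL : L ∈ leaves w p d br.left t) :=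
    h.mem_inter_schedules hp hbr hL hR
  simp only [List.append_assoc] at hmem
  refine ⟨br.job :: R ++ Z, hbr'.isCall_left h.isCall, h.start_eq, ?_, ?_⟩ <;>
    simp only [List.append_assoc]
  · exact fun L hL => (hmem L hL).1
  · exact fun L hL => (hmem L hL).2

lemma IsContext.exists_right (hw : ∀ j, 0 < w j) (hp : ∀ j, 0 < p j)
    (h : IsContext w p (d + 1) (a :: b :: l) t Q A Z)
    (hbr : br ∈ (findStarts w p (precompute w p).val a (b :: l) t).val) :
    ∃ A', IsContext w p d br.right (p br.job + br.start) (Q ∩ br.schedules p) A' Z := by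
  have hbr' := isBranch_of_mem_findStarts hp h.isCall.nodup hbr
  obtain ⟨L, hL⟩ := List.exists_mem_of_ne_nil _ (leaves_ne_nil hw hp (hbr'.isCall_left h.isCall))
  have hmem (R : List (Fin n)) (hR : R ∈ leaves w p d br.right (p br.job + br.start)) :=
    h.mem_inter_schedules hp hbr hL hR
  have hpermL := perm_of_mem_leaves hp (hbr'.isCall_left h.isCall) hL
  have hsplit (R : List (Fin n)) :
      A ++ L ++ [br.job] ++ R ++ Z = A ++ (L ++ br.job :: R) ++ Z := by simp
  refine ⟨A ++ L ++ [br.job], hbr'.isCall_right (fun j => (hp j).le) h.isCall, ?_, ?_, ?_⟩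
  · simp only [endTime_append, endTime_cons, endTime_nil, ← h.start_eq, endTime_perm hpermL,
      hbr'.start_eq]
  · exact fun R hR => hsplit R ▸ (hmem R hR).1
  · exact fun R hR => hsplit R ▸ (hmem R hR).2

lemma Explored.exists_isContext (hw : ∀ j, 0 < w j) (hp : ∀ j, 0 < p j)
    (h : Explored w p J t Q) : ∃ d A Z, IsContext w p d J t Q A Z := by
  induction h with
  | root =>
    exact ⟨n, [], [], isCall_finRange n, by simp,
      fun S hS => by simpa using isSchedule_of_mem_leaves hp hS, fun S hS => by simpa using hS⟩
  | left _ hbr ih =>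
    obtain ⟨_ | d, A, Z, h⟩ := ih
    · exact absurd h.isCall.length_le (by simp)
    · exact ⟨d, A, h.exists_left hw hp hbr⟩
  | right _ hbr ih =>
    obtain ⟨_ | d, A, Z, h⟩ := ih
    · exact absurd h.isCall.length_le (by simp)
    · obtain ⟨A', h'⟩ := h.exists_right hw hp hbr
      exact ⟨d, A', Z, h'⟩

theorem Explored.exists_isPotential (hw : ∀ j, 0 < w j) (hp : ∀ j, 0 < p j)
    (h : Explored w p (a :: b :: l) t Q)
    (hbr : br ∈ (findStarts w p (precompute w p).val a (b :: l) t).val) :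
    ∃ S ∈ Q ∩ br.schedules p, IsPotential w p 0 S := by
  obtain ⟨d, A, Z, hcontext⟩ := (h.left hbr).exists_isContext hw hp
  obtain ⟨S, hS⟩ := List.exists_mem_of_ne_nil _ (leaves_ne_nil hw hp hcontext.isCall)
  exact ⟨_, hcontext.mem S hS, isPotential_of_mem_leaves hw hp (hcontext.mem_leaves S hS)⟩

end Leaves

/-! ### Running time -/

section RunningTime

variable {n : ℕ} {β γ : Type}

lemma time_bind_le {x : Timed β} {f : β → Timed γ} {a b : ℕ} (hx : x.time ≤ a)
    (hf : (f x.val).time ≤ b) : (x >>= f).time ≤ a + b :=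
  Nat.add_le_add hx hf

lemma time_select_le {test : β → Timed Bool} {c : ℕ} (h : ∀ a, (test a).time ≤ c) (l : List β) :
    (select test l).time ≤ (c + 1) * l.length + 1 := by
  induction l with
  | nil => simp [select]
  | cons a l ih =>
    simp only [select, time_bind, time_tick, time_ite, time_pure, List.length_cons, ite_self]
    linarith [h a]

lemma length_select_le (test : β → Timed Bool) (l : List β) :
    (select test l).val.length ≤ l.length := by
  rw [val_select]
  exact List.length_filter_le _ l

lemma time_append (k l : List β) : (append k l).time = k.length + 1 := by
  induction k with
  | nil => rfl
  | cons a k ih =>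
    simp only [append, time_bind, time_tick, time_pure, List.length_cons, ih]
    ring

lemma time_split (l : List β) : (split l).time = l.length + 1 := by
  induction l with
  | nil => rfl
  | cons a l ih =>
    simp only [split, time_bind, time_tick, time_pure, List.length_cons, ih]
    ring

lemma time_merge_le (key : Fin n → ℝ) (k l : List (Fin n)) :
    (merge key k l).time ≤ 4 * (k.length + l.length) + 1 := by
  induction k, l using merge.induct with
  | case1 l => simp [merge]
  | case2 a k => simp [merge]
  | case3 a k b l ih_left ih_right =>
    simp only [merge, time_bind, time_tick, time_ite, time_pure, time_read, time_leR,
      List.length_cons] at ih_left ih_right ⊢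
    split_ifs <;> linarith

lemma half_mul_clog_add_half_mul_clog_le {m : ℕ} (hm : 2 ≤ m) :
    (m + 1) / 2 * Nat.clog 2 ((m + 1) / 2) + m / 2 * Nat.clog 2 (m / 2) + m ≤
      m * Nat.clog 2 m := by
  have hmono : Nat.clog 2 (m / 2) ≤ Nat.clog 2 ((m + 1) / 2) := Nat.clog_mono_right 2 (by omega)
  have hclog : Nat.clog 2 m = Nat.clog 2 ((m + 1) / 2) + 1 := Nat.clog_of_two_le one_lt_two hm
  calc (m + 1) / 2 * Nat.clog 2 ((m + 1) / 2) + m / 2 * Nat.clog 2 (m / 2) + m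
      ≤ (m + 1) / 2 * Nat.clog 2 ((m + 1) / 2) + m / 2 * Nat.clog 2 ((m + 1) / 2) + m := by
        gcongr
    _ = m * Nat.clog 2 m := by
        rw [hclog, ← add_mul, show (m + 1) / 2 + m / 2 = m by omega, mul_add, mul_one]

lemma time_mergeSort_le (key : Fin n → ℝ) (d : ℕ) {l : List (Fin n)} (hl : l ≠ []) :
    (mergeSort key d l).time ≤ 8 * (l.length * Nat.clog 2 l.length) + l.length := by
  induction d generalizing l with
  | zero => exact (List.length_pos_of_ne_nil hl).trans_le (Nat.le_add_left _ _)
  | succ d ih =>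
    match l with
    | [] => exact absurd rfl hl
    | [a] => simp [mergeSort]
    | a :: b :: l =>
      have hm : 2 ≤ (a :: b :: l).length := by simp
      have hsplit := length_split (a :: b :: l)
      have hhalves := half_mul_clog_add_half_mul_clog_le hm
      have hleft := ih (l := (split (a :: b :: l)).val.1) (List.length_pos_iff.1 (by omega))
      have hright := ih (l := (split (a :: b :: l)).val.2) (List.length_pos_iff.1 (by omega))
      rw [hsplit.1] at hleft
      rw [hsplit.2] at hright
      rw [mergeSort]
      refine le_trans (time_bind_le time_tick.le (time_bind_le (time_split _).le
        (time_bind_le hleft (time_bind_le hright (time_merge_le key _ _))))) ?_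
      rw [(mergeSort_perm key d _).length_eq, (mergeSort_perm key d _).length_eq, hsplit.1,
        hsplit.2]
      omega

lemma time_fill_le {f : Fin n → Timed β} {c : ℕ} (h : ∀ i, (f i).time ≤ c) :
    (fill f).time ≤ 1 + n * (c + 1) := by
  have hsum := Finset.sum_le_card_nsmul Finset.univ (fun i => (f i).time + 1) (c + 1)
    fun i _ => Nat.succ_le_succ (h i)
  rw [Finset.card_univ, Fintype.card_fin, smul_eq_mul] at hsum
  exact Nat.add_le_add_left hsum 1

lemma time_evalCrossing_le (w p : Fin n → ℝ) (i j : Fin n) : (evalCrossing w p i j).time ≤ 13 := by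
  simp only [evalCrossing, time_bind, time_tick, time_ite, time_read, time_mulR, time_subR,
    time_divR, time_eqR, time_pure]
  split_ifs <;> norm_num

lemma time_precompute_le (w p : Fin n → ℝ) (hn : 1 ≤ n) :
    (precompute w p).time ≤ 16 * (n ^ 2 * Nat.clog 2 n) + 40 * n ^ 2 := by
  have hsort (key : Fin n → ℝ) : (mergeSort key n (allJobs n).val).time ≤
      8 * (n * Nat.clog 2 n) + n := by
    have hne : List.finRange n ≠ [] := List.length_pos_iff.1 (by rwa [List.length_finRange])
    have hle := time_mergeSort_le key n hne
    rwa [List.length_finRange] at hle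
  rw [precompute]
  refine le_trans (time_bind_le time_tick.le
    (time_bind_le (time_fill_le fun i => time_fill_le fun j => time_evalCrossing_le w p i j)
    (time_bind_le (time_fill_le fun i => time_fill_le (c := 4) fun j => by simp)
    (time_bind_le (time_fill_le fun i => time_bind_le (time_read _ _).le
      (time_bind_le time_allJobs.le (hsort _)))
    (time_bind_le (time_fill_le fun i => time_bind_le (time_read _ _).le
      (time_bind_le time_allJobs.le (hsort _))) (time_pure _).le))))) ?_
  have hsq : n ≤ n ^ 2 := Nat.le_self_pow two_ne_zero n
  linarith

lemma time_sumFrom (p : Fin n → ℝ) (t : ℝ) (l : List (Fin n)) :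
    (sumFrom p t l).time = 3 * l.length + 1 := by
  induction l generalizing t with
  | nil => rfl
  | cons a l ih =>
    simp only [sumFrom, time_bind, time_tick, time_read, time_addR, List.length_cons, ih]
    ring

lemma time_evalPhi (w p : Fin n → ℝ) (j : Fin n) (t : ℝ) : (evalPhi w p j t).time = 6 := rfl

lemma time_findAlpha_le (w p : Fin n → ℝ) (t te : ℝ) (a : Fin n) (l : List (Fin n)) :
    (findAlpha w p t te a l).time ≤ 28 * l.length + 1 := by
  induction l generalizing a with
  | nil => simp [findAlpha]
  | cons j l ih =>
    have ih_keep := ih a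
    have ih_replace := ih j
    simp only [findAlpha, time_bind, time_tick, time_ite, time_evalPhi, time_ltR, List.length_cons]
    split_ifs <;> linarith

lemma time_mark (m : Fin n → Bool) (l : List (Fin n)) : (mark m l).time = 2 * l.length + 1 := by
  induction l generalizing m with
  | nil => rfl
  | cons a l ih =>
    simp only [mark, time_bind, time_tick, time_write, List.length_cons, ih]
    ring

lemma time_crossesIn (T : Tables n) (α : Fin n) (t te : ℝ) (j : Fin n) :
    (crossesIn T α t te j).time = 5 := rfl

lemma time_isBreak (T : Tables n) (α : Fin n) (t te : ℝ) (j : Fin n) :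
    (isBreak T α t te j).time = 9 := rfl

-- The intervals that are dropped pay for the sweep, so its cost over a whole `scan` telescopes.
lemma time_sweep_le (T : Tables n) (α : Fin n) (s : ℝ) (bans : List (Fin n)) (m : ℝ) :
    (sweep T α s bans m).time + 7 * (sweep T α s bans m).val.1.length ≤ 7 * bans.length + 4 := by
  induction bans generalizing m with
  | nil => simp [sweep]
  | cons j l ih =>
    have ih_keep := ih m
    have ih_update := ih (T.exit α j)
    simp only [sweep, time_bind, val_bind, time_ite, val_ite, time_tick, time_read, val_read,
      time_leR, time_ltR, time_pure, val_pure, List.length_cons]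
    split_ifs
    · linarith
    · linarith
    · rw [List.length_cons]
      linarith

lemma time_scan_le (p : Fin n → ℝ) (T : Tables n) (α : Fin n) (te : ℝ) (bs : List (Fin n))
    (c s : ℝ) (left right bans : List (Fin n)) (m : ℝ) :
    (scan p T α te bs c s left right bans m).time ≤ 12 * (bs.length + 1) + 7 * bans.length := by
  induction bs generalizing c s left right bans m with
  | nil =>
    have hsweep := time_sweep_le T α s bans m
    simp only [scan, time_bind, time_ite, time_tick, time_leR, time_ltR, time_pure, ite_self,
      List.length_nil]
    linarith
  | cons j bs ih =>
    have hsweep := time_sweep_le T α s bans m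
    have hrest := ih (T.exit α j) (s + p j) (j :: left) right.tail
      (sweep T α s bans m).val.1 (sweep T α s bans m).val.2
    simp only [scan, time_bind, time_ite, time_tick, time_leR, time_ltR, time_pure, ite_self,
      time_read, val_read, time_addR, val_addR, List.length_cons]
    linarith

lemma length_le_of_nodup {l : List (Fin n)} (h : l.Nodup) : l.length ≤ n := by
  simpa using h.length_le_card

lemma time_findStarts_le (w p : Fin n → ℝ) {a : Fin n} {l : List (Fin n)} (t : ℝ)
    (hnd : (a :: l).Nodup) :
    (findStarts w p (precompute w p).val a l t).time ≤ 150 * n := by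
  have hlen := length_le_of_nodup hnd
  have hexit (i : Fin n) : ((precompute w p).val.byExit i).length = n := by
    simp [precompute_byExit, (mergeSort_perm _ _ _).length_eq]
  have hcross (i : Fin n) : ((precompute w p).val.byCross i).length = n := by
    simp [precompute_byCross, (mergeSort_perm _ _ _).length_eq]
  have hbreaks (test : Fin n → Timed Bool) (i : Fin n) :
      (select test ((precompute w p).val.byExit i)).val.length ≤ n :=
    (length_select_le _ _).trans (hexit i).le
  have hbans (test : Fin n → Timed Bool) (i : Fin n) :
      (select test ((precompute w p).val.byCross i)).val.length ≤ n :=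
    (length_select_le _ _).trans (hcross i).le
  rw [findStarts]
  refine le_trans (time_bind_le time_tick.le
    (time_bind_le (time_sumFrom p t _).le
    (time_bind_le (time_findAlpha_le w p t _ a l)
    (time_bind_le (time_fill_le (c := 0) fun _ => le_rfl)
    (time_bind_le (time_mark _ _).le
    (time_bind_le (time_write _ _ _).le
    (time_bind_le (time_read _ _).le
    (time_bind_le (time_select_le (c := 10) (fun j => by simp [time_isBreak]) _)
    (time_bind_le (time_read _ _).le
    (time_bind_le (time_select_le (c := 6) (fun j => by simp [time_crossesIn]) _)
    (time_bind_le (time_select_le (c := 10) (fun j => by simp [time_isBreak]) _)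
    (time_bind_le ((time_append _ _).le.trans (Nat.succ_le_succ (hbreaks _ _)))
    ((time_scan_le _ _ _ _ _ _ _ _ _ _ _).trans (Nat.add_le_add
      (Nat.mul_le_mul_left 12 (Nat.succ_le_succ (hbreaks _ _)))
      (Nat.mul_le_mul_left 7 (hbans _ _)))))))))))))))) ?_
  simp only [val_read, hexit, hcross]
  rw [List.length_cons] at hlen ⊢
  omega

lemma time_foldlM_le {f : β → γ → Timed β} {g : γ → ℕ} {l : List γ}
    (h : ∀ b, ∀ c ∈ l, (f b c).time ≤ g c) (b : β) : (l.foldlM f b).time ≤ (l.map g).sum := by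
  induction l generalizing b with
  | nil => exact le_rfl
  | cons c l ih =>
    rw [List.foldlM_cons, List.map_cons, List.sum_cons]
    exact time_bind_le (h b c List.mem_cons_self)
      (ih (fun b c hc => h b c (List.mem_cons_of_mem _ hc)) _)

variable {w p : Fin n → ℝ} {d : ℕ} {a b : Fin n} {l J : List (Fin n)} {t : ℝ}

lemma length_leaves_cons_cons :
    (leaves w p (d + 1) (a :: b :: l) t).length =
      ((findStarts w p (precompute w p).val a (b :: l) t).val.map fun br =>
        (leaves w p d br.left t).length *
          (leaves w p d br.right (p br.job + br.start)).length).sum := by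
  simp [leaves, List.length_flatMap]

lemma time_fastSchedule_cons_cons_le (hw : ∀ j, 0 < w j) (hp : ∀ j, 0 < p j)
    (h : IsCall (d + 1) (a :: b :: l) t) :
    (fastSchedule w p (precompute w p).val (d + 1) (a :: b :: l) t).time ≤ 1 + (150 * n +
      ((findStarts w p (precompute w p).val a (b :: l) t).val.map fun br =>
        (fastSchedule w p (precompute w p).val d br.left t).time +
          (fastSchedule w p (precompute w p).val d br.right (p br.job + br.start)).time +
            10 * n).sum) := by
  rw [fastSchedule]
  refine time_bind_le time_tick.le (time_bind_le (time_findStarts_le w p t h.nodup)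
    (time_foldlM_le (fun best br hbr => ?_) _))
  have hbr' := isBranch_of_mem_findStarts hp h.nodup hbr
  have hseq : (fastSchedule w p (precompute w p).val d br.left t).val.2.length + 1 ≤ n := by
    rw [(isSolution_fastSchedule hw hp (hbr'.isCall_left h)).1.1.length_eq]
    have hlen := length_le_of_nodup (hbr'.nodup h.nodup)
    rw [List.length_append, List.length_cons] at hlen
    omega
  simp only [time_bind, time_tick, time_ite, time_read, time_addR, time_divR, time_ltR,
    time_append, time_pure, val_read, val_addR]
  split_ifs <;> omega

lemma mul_add_mul_add_le_mul {x y : ℕ} (hx : 1 ≤ x) (hy : 1 ≤ y) (A B c : ℕ) :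
    A * x + B * y + c ≤ (A + B + c) * (x * y) := by
  have hxxy : x ≤ x * y := Nat.le_mul_of_pos_right x hy
  have hyxy : y ≤ x * y := Nat.le_mul_of_pos_left y hx
  calc A * x + B * y + c ≤ A * (x * y) + B * (x * y) + c * (x * y) := by
        gcongr
        exact Nat.le_mul_of_pos_right c (Nat.mul_pos hx hy)
    _ = (A + B + c) * (x * y) := by ring

lemma time_fastSchedule_cons_cons_le_mul (hw : ∀ j, 0 < w j) (hp : ∀ j, 0 < p j)
    (h : IsCall (d + 1) (a :: b :: l) t) {c : ℕ}
    (hrec : ∀ br ∈ (findStarts w p (precompute w p).val a (b :: l) t).val,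
      (fastSchedule w p (precompute w p).val d br.left t).time ≤
          c * (2 * br.left.length + 1) * (leaves w p d br.left t).length ∧
        (fastSchedule w p (precompute w p).val d br.right (p br.job + br.start)).time ≤
          c * (2 * br.right.length + 1) *
            (leaves w p d br.right (p br.job + br.start)).length) :
    (fastSchedule w p (precompute w p).val (d + 1) (a :: b :: l) t).time ≤
      1 + (150 * n + (c * (2 * (a :: b :: l).length) + 10 * n) *
        (leaves w p (d + 1) (a :: b :: l) t).length) := by
  refine (time_fastSchedule_cons_cons_le hw hp h).trans ?_
  rw [length_leaves_cons_cons, ← List.sum_map_mul_left]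
  refine Nat.add_le_add_left (Nat.add_le_add_left (List.sum_le_sum fun br hbr => ?_) _) _
  have hbr' := isBranch_of_mem_findStarts hp h.nodup hbr
  have hleft := List.length_pos_of_ne_nil (leaves_ne_nil hw hp (hbr'.isCall_left h))
  have hright := List.length_pos_of_ne_nil
    (leaves_ne_nil hw hp (hbr'.isCall_right (fun j => (hp j).le) h))
  have hlen : (a :: b :: l).length = br.left.length + br.right.length + 1 := by
    rw [← hbr'.perm.length_eq, List.length_append, List.length_cons, add_assoc]
  refine (Nat.add_le_add_right (Nat.add_le_add (hrec br hbr).1 (hrec br hbr).2) _).trans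
    ((mul_add_mul_add_le_mul hleft hright _ _ _).trans_eq ?_)
  rw [hlen]
  ring

-- A leaf of the recursion on `J` is reached through at most `2 * J.length + 1` calls, those on the
-- empty set included.
lemma time_fastSchedule_le (hw : ∀ j, 0 < w j) (hp : ∀ j, 0 < p j) (hn : 1 ≤ n)
    (h : IsCall d J t) :
    (fastSchedule w p (precompute w p).val d J t).time ≤
      161 * n * (2 * J.length + 1) * (leaves w p d J t).length := by
  refine IsCall.induction (w := w) (motive := fun d J t =>
    (fastSchedule w p (precompute w p).val d J t).time ≤
      161 * n * (2 * J.length + 1) * (leaves w p d J t).length) hp ?_ ?_ ?_ h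
  · intro d t
    cases d <;> simp only [fastSchedule, leaves, time_bind, time_tick, time_pure, List.length_nil,
      List.length_singleton] <;> omega
  · intro d j t
    simp only [fastSchedule, leaves, time_bind, time_tick, time_pure, time_read, time_addR,
      time_divR, List.length_singleton]
    omega
  intro d a b l t h ih
  refine (time_fastSchedule_cons_cons_le_mul hw hp h ih).trans ?_
  have hcall : 151 * n * 1 ≤ 151 * n * (leaves w p (d + 1) (a :: b :: l) t).length :=
    Nat.mul_le_mul_left _ (List.length_pos_of_ne_nil (leaves_ne_nil hw hp h))
  linarith

lemma clog_le_log (n : ℕ) : (Nat.clog 2 n : ℝ) ≤ 2 / Real.log 2 * Real.log n := by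
  rcases lt_or_ge n 2 with hn | hn
  · rw [Nat.clog_of_right_le_one (Nat.le_of_lt_succ hn), Nat.cast_zero]
    exact mul_nonneg (by positivity) (Real.log_natCast_nonneg n)
  have hclog : (Nat.clog 2 n : ℝ) ≤ Nat.log 2 n + 1 := by
    exact_mod_cast Nat.clog_le_of_le_pow (Nat.lt_pow_succ_log_self one_lt_two n).le
  have hone : (1 : ℝ) ≤ Nat.log 2 n := by exact_mod_cast Nat.log_pos one_lt_two hn
  calc (Nat.clog 2 n : ℝ) ≤ 2 * Nat.log 2 n := by linarith
    _ ≤ 2 * (Real.log n / Real.log 2) := by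
        gcongr
        exact Real.natLog_le_logb n 2
    _ = 2 / Real.log 2 * Real.log n := by ring

lemma time_precompute_le_log_add (w p : Fin n → ℝ) (hn : 1 ≤ n) :
    ((precompute w p).time : ℝ) ≤
      32 / Real.log 2 * ((n : ℝ) ^ 2 * Real.log n) + 40 * (n : ℝ) ^ 2 := by
  calc ((precompute w p).time : ℝ)
      ≤ 16 * ((n : ℝ) ^ 2 * Nat.clog 2 n) + 40 * (n : ℝ) ^ 2 := by
        exact_mod_cast time_precompute_le w p hn
    _ ≤ 16 * ((n : ℝ) ^ 2 * (2 / Real.log 2 * Real.log n)) + 40 * (n : ℝ) ^ 2 := by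
        gcongr
        exact clog_le_log n
    _ = 32 / Real.log 2 * ((n : ℝ) ^ 2 * Real.log n) + 40 * (n : ℝ) ^ 2 := by ring

lemma time_precompute_le_log (w p : Fin n → ℝ) (hn : 2 ≤ n) :
    ((precompute w p).time : ℝ) ≤ 72 / Real.log 2 * ((n : ℝ) ^ 2 * Real.log n) := by
  have hlog : Real.log 2 ≤ Real.log n := Real.log_le_log two_pos (by exact_mod_cast hn)
  have hsq : (n : ℝ) ^ 2 ≤ 1 / Real.log 2 * ((n : ℝ) ^ 2 * Real.log n) := by
    rw [one_div_mul_eq_div, le_div_iff₀ (Real.log_pos one_lt_two)]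
    gcongr
  calc ((precompute w p).time : ℝ)
      ≤ 32 / Real.log 2 * ((n : ℝ) ^ 2 * Real.log n) + 40 * (n : ℝ) ^ 2 :=
        time_precompute_le_log_add w p (one_le_two.trans hn)
    _ ≤ 32 / Real.log 2 * ((n : ℝ) ^ 2 * Real.log n) +
          40 * (1 / Real.log 2 * ((n : ℝ) ^ 2 * Real.log n)) := by gcongr
    _ = 72 / Real.log 2 * ((n : ℝ) ^ 2 * Real.log n) := by ring

lemma one_le_numPotential (hw : ∀ j, 0 < w j) (hp : ∀ j, 0 < p j) : 1 ≤ numPotential w p :=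
  (List.length_pos_of_ne_nil (leaves_ne_nil hw hp (isCall_finRange n))).trans_le
    (length_leaves_le_numPotential hw hp)

lemma time_solve_le_precompute_add (hw : ∀ j, 0 < w j) (hp : ∀ j, 0 < p j) (hn : 1 ≤ n) :
    (solve w p).time ≤ (precompute w p).time + 486 * (n ^ 2 * numPotential w p) := by
  have hK := one_le_numPotential hw hp
  have hn2 : n ≤ n ^ 2 := Nat.le_self_pow two_ne_zero n
  have hone : n ^ 2 * 1 ≤ n ^ 2 * numPotential w p := Nat.mul_le_mul_left _ hK
  have hfast : (fastSchedule w p (precompute w p).val n (List.finRange n) 0).time ≤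
      483 * (n ^ 2 * numPotential w p) := by
    calc (fastSchedule w p (precompute w p).val n (List.finRange n) 0).time
        ≤ 161 * n * (2 * n + 1) * (leaves w p n (List.finRange n) 0).length := by
          simpa using time_fastSchedule_le hw hp hn (isCall_finRange n)
      _ ≤ 161 * n * (2 * n + n) * numPotential w p := by
          gcongr
          exact length_leaves_le_numPotential hw hp
      _ = 483 * (n ^ 2 * numPotential w p) := by ring
  rw [solve]
  refine le_trans (time_bind_le time_tick.le (time_bind_le le_rfl
    (time_bind_le time_allJobs.le hfast))) ?_
  linarith

theorem time_solve_le (hw : ∀ j, 0 < w j) (hp : ∀ j, 0 < p j) (hn : 1 ≤ n) :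
    ((solve w p).time : ℝ) ≤
      (32 / Real.log 2 + 526) * ((n : ℝ) ^ 2 * (Real.log n + numPotential w p)) := by
  have hK : (1 : ℝ) ≤ numPotential w p := by exact_mod_cast one_le_numPotential hw hp
  have hsolve : ((solve w p).time : ℝ) ≤
      (precompute w p).time + 486 * ((n : ℝ) ^ 2 * numPotential w p) := by
    exact_mod_cast time_solve_le_precompute_add hw hp hn
  have hsq : (n : ℝ) ^ 2 * 1 ≤ (n : ℝ) ^ 2 * numPotential w p := by gcongr
  calc ((solve w p).time : ℝ)
      ≤ 32 / Real.log 2 * ((n : ℝ) ^ 2 * Real.log n) +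
          526 * ((n : ℝ) ^ 2 * numPotential w p) := by
        linarith [time_precompute_le_log_add w p hn]
    _ ≤ (32 / Real.log 2 + 526) * ((n : ℝ) ^ 2 * Real.log n) +
          (32 / Real.log 2 + 526) * ((n : ℝ) ^ 2 * numPotential w p) := by
        gcongr
        · exact le_add_of_nonneg_right (by norm_num)
        · exact le_add_of_nonneg_left (by positivity)
    _ = (32 / Real.log 2 + 526) * ((n : ℝ) ^ 2 * (Real.log n + numPotential w p)) := by ring

end RunningTime

end

end Refueling

theorem mainTheorem2 :
    (∀ (n : ℕ) (w p : Fin n → ℝ), (∀ j, 0 < w j) → (∀ j, 0 < p j) →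
      Refueling.IsOptimal w p (Refueling.solve w p).val.2 ∧
      (Refueling.solve w p).val.1 = -Refueling.cost w p 0 (Refueling.solve w p).val.2) ∧
    (∃ C : ℝ, ∀ (n : ℕ) (w p : Fin n → ℝ), 1 ≤ n → (∀ j, 0 < w j) → (∀ j, 0 < p j) →
      ((Refueling.solve w p).time : ℝ) ≤
        C * ((n : ℝ) ^ 2 * (Real.log n + Refueling.numPotential w p)) ∧
      (2 ≤ n → ((Refueling.precompute w p).time : ℝ) ≤ C * ((n : ℝ) ^ 2 * Real.log n)) ∧
      (∀ (a : Fin n) (l : List (Fin n)) (t : ℝ), (a :: l).Nodup →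
        ((Refueling.findStarts w p (Refueling.precompute w p).val a l t).time : ℝ) ≤ C * n)) ∧
    (∀ (n : ℕ) (w p : Fin n → ℝ), (∀ j, 0 < w j) → (∀ j, 0 < p j) →
      ∀ (a b : Fin n) (l : List (Fin n)) (t : ℝ) (Q : Set (List (Fin n))),
        Refueling.Explored w p (a :: b :: l) t Q →
        ∀ br ∈ (Refueling.findStarts w p (Refueling.precompute w p).val a (b :: l) t).val,
          ∃ S ∈ Q ∩ br.schedules p, Refueling.IsPotential w p 0 S) := by
  refine ⟨fun n w p hw hp => Refueling.solve_isOptimal hw hp,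
    ⟨72 / Real.log 2 + 526, fun n w p hn hw hp => ⟨?_, fun h2 => ?_, fun a l t hnd => ?_⟩⟩,
    fun n w p hw hp a b l t Q h br hbr => h.exists_isPotential hw hp hbr⟩
  · refine (Refueling.time_solve_le hw hp hn).trans ?_
    gcongr
    norm_num
  · refine (Refueling.time_precompute_le_log w p h2).trans ?_
    gcongr
    linarith
  · calc ((Refueling.findStarts w p (Refueling.precompute w p).val a l t).time : ℝ)
        ≤ 150 * n := by exact_mod_cast Refueling.time_findStarts_le w p t hnd
      _ ≤ (72 / Real.log 2 + 526) * n := by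
        gcongr
        linarith [show 0 < 72 / Real.log 2 by positivity]
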